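/- **Setting.** There are $K\ge 1$ arms and $N$ agents. In slot $t=1,2,\dots$ arm $k$ has reward $r_k^t\in[0,1]$, and agent $n$ has a private cost vector $c_n^t=(c_{n,k}^t)_k\in[c_{\min},1]^K$, where $c_{\min}\ge 0$. The reward vectors $r^t$ are IID over $t$, the cost vectors $c_n^t$ are IID over $n$ and $t$, and rewards and costs are independent; put $\bar r_k=\mathbb E[r_k^t]$. Let $\mathcal X$ be the set of matrices $x\in\{0,1\}^{N\times K}$ with all row and column sums at most $1$. In the system $\mathcal H(\alpha,N)$, $\alpha>0$, every agent has the utilization cap $\phi_n=\alpha/N$, so $\Phi=\sum_n\phi_n=\alpha$. For $x\in\mathcal X$ and decisions $a\in\{0,1\}^N$ let $f_n(x,a)=\sum_k x_{n,k}a_n$, $V=\sum_{k,n}r_kx_{n,k}a_n$ and $S(x,a;r,c)=V-\sum_{n,k}c_{n,k}x_{n,k}a_n$. **Mechanism $\mathfrak A$ with horizon $T$.** Put $\Theta=\min(K+\Phi,N)$ and $\eta=\frac{4K+2\sqrt{6KT\Phi\ln T}}{T\Theta}$. Start with $\lambda^1=0$ and $H_k^0=0$. In slot $t$, let $\hat r_k^t=\min\big(\tilde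 r_k^{t-1}+\sqrt{3\ln t/(2H_k^{t-1})},1\big)$ if $H_k^{t-1}>0$ and $\hat r_k^t=1$ otherwise, where $H_k^{t-1}$ is the number of past observations of arm $k$ and $\tilde r_k^{t-1}$ their average. Let $\mathcal L(x,\lambda;r,c)=S(x,\mathbf 1;r,c)-\sum_n\lambda_n(f_n(x,\mathbf 1)-\phi_n)$. From the bids $\hat c^t$ the mechanism takes a maximizer $\hat x^t$ of $\mathcal L(\cdot,\lambda^t;\hat r^t,\hat c^t)$ over $\mathcal X$ (ties broken by any fixed measurable rule), and offers agent $n$ the payment $\hat y_n^t=\sum_k(\hat r_k^t-\lambda_n^t)\hat x_{n,k}^t-\big[\max_{x\in\mathcal X}\mathcal L_{-n}(x)-\mathcal L_{-n}(\hat x^t)\big]$, where $\mathcal L_{-n}(x)=\sum_{k}\sum_{i\ne n}(\hat r_k^t-\hat c_{i,k}^t)x_{i,k}-\sum_{i\neq n}\lambda_i^tf_i(x,\mathbf 1)+\sum_i\lambda_i^t\phi_i$. Agents bid truthfully, $\hat c^t=c^t$, and agent $n$ follows ($\hat a_n^t=1$) iff the payment covers the cost. Then $\lambda_n^{t+1}=\max\big(\lambda_n^t+\eta(f_n(\hat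 x^t,\mathbf 1)-\phi_n),0\big)$, and $H_k,\tilde r_k$ are updated with the observed rewards. **Performance.** Let $S^*$ be the supremum of $\mathbb E\big[\sum_{k,n}(\bar r_k-c_{n,k})x_{n,k}(c)\big]$ over measurable policies $x(\cdot)$ from cost matrices to $\mathcal X$ with $\mathbb E[f_n(x(c),\mathbf 1)]\le\phi_n$ for all $n$, and $S^\dagger$ the maximum of $\sum_k(\bar r_k-c_{\min})p_k$ over $p\in[0,1]^K$ with $\sum_kp_k\le\Phi$. Let $\mathrm{Reg}(T)=\sum_{t\le T}(S^*-\mathbb E[S(\hat x^t,\hat a^t;r^t,c^t)])$, $\mathrm{Deg}(T)=\sum_{t\le T}(S^\dagger-\mathbb E[S(\hat x^t,\hat a^t;r^t,c^t)])$, $\mathrm{Vio}(T)=\sum_n\mathbb E\big(\sum_{t\le T}[f_n(\hat x^t,\hat a^t)-\phi_n]\big)^+$ and $\mathrm{Pro}(T)=\sum_{t\le T}\mathbb E\big[V(\hat x^t,\hat a^t;r^t)-\sum_n\hat a_n^t\hat y_n^t\big]$. **Corollary.** Let $\beta\in(0,\frac13)$, and let $N=\lfloor\alpha^{1/3}T^\beta\rfloor$.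 In $\mathcal H(\alpha,N)$ truthful bidding followed by acceptance is a dominant strategy of every agent in every slot, and $\hat a_n^t=1$ for all $n,t$. There is an absolute constant $C>0$ such that, for all $T\ge T_0$, where $T_0$ does not depend on the laws of rewards and costs, $$\mathrm{Reg}(T)\le C\sqrt{\alpha KT\ln T},\qquad \mathrm{Vio}(T)\le C\,\frac K\alpha\sqrt{KT^{1+3\beta}},\qquad \mathrm{Pro}(T)+C\sqrt{\alpha KT\ln T}\ge 0 .$$ If moreover $c_{\min}$ is the potential minimal cost in the sense that, for some $\kappa>0$, $\mathbb P(c_{n,k}^t\le c_{\min}+s)\ge\kappa s$ for all $n,k,t$ and all $s\in[0,1-c_{\min}]$ (for example, if each $c_{n,k}^t$ has a density that is at least $\kappa$ on $[c_{\min},1]$), then, for a constant $D$ depending only on $K$ and $\kappa$ and all $T\ge T_0$ (with $T_0$ now depending on $\kappa$ too), $$\mathrm{Deg}(T)\le D\,\alpha^{2/3}T^{1-\beta}.$$ In particular the degradation is sublinear: for every $\varepsilon>0$, $\mathrm{Deg}(T)\le\varepsilon T$ once $T$ is large enough. -/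

import Mathlib

open MeasureTheory ProbabilityTheory

noncomputable section

namespace IOL

/-- Feasible assignments: 0-1 matrices in which every agent pulls at most one arm and every arm
is pulled by at most one agent. -/
def assignments (N K : ℕ) : Set (Fin N → Fin K → ℝ) :=
  {x | (∀ n k, x n k = 0 ∨ x n k = 1) ∧ (∀ n, ∑ k, x n k ≤ 1) ∧ (∀ k, ∑ n, x n k ≤ 1)}

/-- Utilization indicator of agent `n` under assignment `x` and decisions `a`. -/
def util {N K : ℕ} (x : Fin N → Fin K → ℝ) (a : Fin N → ℝ) (n : Fin N) : ℝ :=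
  ∑ k, x n k * a n

/-- The principal's reward. -/
def reward {N K : ℕ} (x : Fin N → Fin K → ℝ) (a : Fin N → ℝ) (r : Fin K → ℝ) : ℝ :=
  ∑ k, ∑ n, r k * x n k * a n

/-- The total cost incurred by the agents. -/
def cost {N K : ℕ} (x : Fin N → Fin K → ℝ) (a : Fin N → ℝ) (c : Fin N → Fin K → ℝ) : ℝ :=
  ∑ n, ∑ k, c n k * x n k * a n

/-- Social welfare. -/
def welfare {N K : ℕ} (x : Fin N → Fin K → ℝ) (a : Fin N → ℝ) (r : Fin K → ℝ)
    (c : Fin N → Fin K → ℝ) : ℝ :=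
  reward x a r - cost x a c

/-- The Lagrangian, with utilization caps `φ` and multipliers `lam`. -/
def lagrangian {N K : ℕ} (φ : Fin N → ℝ) (x : Fin N → Fin K → ℝ) (lam : Fin N → ℝ)
    (r : Fin K → ℝ) (c : Fin N → Fin K → ℝ) : ℝ :=
  welfare x 1 r c - ∑ n, lam n * (util x 1 n - φ n)

/-- The Lagrangian in the absence of agent `n`. -/
def lagrangianWithout {N K : ℕ} (φ : Fin N → ℝ) (n : Fin N) (x : Fin N → Fin K → ℝ)
    (lam : Fin N → ℝ) (r : Fin K → ℝ) (c : Fin N → Fin K → ℝ) : ℝ :=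
  ∑ k, ∑ i ∈ Finset.univ.erase n, (r k - c i k) * x i k
    - ∑ i ∈ Finset.univ.erase n, lam i * util x 1 i + ∑ i, lam i * φ i

/-- The maximum of the Lagrangian in the absence of agent `n` (over the finite nonempty set of
feasible assignments). -/
def lagrangianWithoutMax {N K : ℕ} (φ : Fin N → ℝ) (n : Fin N)
    (lam : Fin N → ℝ) (r : Fin K → ℝ) (c : Fin N → Fin K → ℝ) : ℝ :=
  sSup ((fun x => lagrangianWithout φ n x lam r c) '' assignments N K)

/-- The auction payment to agent `n`, given the adopted assignment `x`, the multipliers `lam`,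
the estimated rewards `rh` and the bids `bid`. -/
def payment {N K : ℕ} (φ : Fin N → ℝ) (x : Fin N → Fin K → ℝ) (lam : Fin N → ℝ)
    (rh : Fin K → ℝ) (bid : Fin N → Fin K → ℝ) (n : Fin N) : ℝ :=
  ∑ k, (rh k - lam n) * x n k
    - (lagrangianWithoutMax φ n lam rh bid - lagrangianWithout φ n x lam rh bid)

/-- A rule that picks, from the multipliers, the estimated rewards and the bids, a feasible
assignment maximizing the Lagrangian. The rule resolves ties, in an arbitrary measurable way. -/
structure AssignmentRule {N : ℕ} (K : ℕ) (φ : Fin N → ℝ) where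
  sel : (Fin N → ℝ) → (Fin K → ℝ) → (Fin N → Fin K → ℝ) → (Fin N → Fin K → ℝ)
  measurable_sel : Measurable
    (fun p : (Fin N → ℝ) × (Fin K → ℝ) × (Fin N → Fin K → ℝ) => sel p.1 p.2.1 p.2.2)
  sel_mem : ∀ lam rh bid, sel lam rh bid ∈ assignments N K
  sel_max : ∀ lam rh bid, ∀ x ∈ assignments N K,
    lagrangian φ x lam rh bid ≤ lagrangian φ (sel lam rh bid) lam rh bid

/-- The payoff in one slot of agent `n` with true cost vector `γ` and decision `d` (`1`: follow,
`0`: decline) when the submitted bids are `bid`. -/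
def auctionPayoff {N K : ℕ} {φ : Fin N → ℝ} (R : AssignmentRule K φ) (lam : Fin N → ℝ)
    (rh : Fin K → ℝ) (bid : Fin N → Fin K → ℝ) (n : Fin N) (γ : Fin K → ℝ) (d : ℝ) : ℝ :=
  (payment φ (R.sel lam rh bid) lam rh bid n - ∑ k, γ k * R.sel lam rh bid n k) * d

/-- Bidding the true cost vector and then following the proposal is a dominant strategy: whatever
the state and the bids of the others, no other bid and decision of the agent pays more. -/
def TruthfulDominant {N K : ℕ} {φ : Fin N → ℝ} (R : AssignmentRule K φ) : Prop :=
  ∀ (lam : Fin N → ℝ) (rh : Fin K → ℝ) (bid : Fin N → Fin K → ℝ) (n : Fin N) (γ : Fin K → ℝ)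
    (d : ℝ), d = 0 ∨ d = 1 →
    auctionPayoff R lam rh bid n γ d ≤ auctionPayoff R lam rh (Function.update bid n γ) n γ 1

/-- Internal state of the mechanism between two slots. -/
structure State (N K : ℕ) where
  /-- Lagrange multipliers -/
  lam : Fin N → ℝ
  /-- number of observations of each arm -/
  count : Fin K → ℝ
  /-- empirical average reward of each arm -/
  avg : Fin K → ℝ

/-- Estimated rewards (upper confidence bounds, truncated at `1`) in slot number `τ`. -/
def ucb {N K : ℕ} (τ : ℕ) (s : State N K) (k : Fin K) : ℝ :=
  if s.count k = 0 then 1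
  else min (s.avg k + √(3 * Real.log τ / (2 * s.count k))) 1

/-- Assignment proposed in slot number `τ` when the agents with costs `c` bid truthfully. -/
def slotAssign {N K : ℕ} {φ : Fin N → ℝ} (R : AssignmentRule K φ) (τ : ℕ) (s : State N K)
    (c : Fin N → Fin K → ℝ) : Fin N → Fin K → ℝ :=
  R.sel s.lam (ucb τ s) c

/-- Payments proposed in slot number `τ` when the agents with costs `c` bid truthfully. -/
def slotPay {N K : ℕ} {φ : Fin N → ℝ} (R : AssignmentRule K φ) (τ : ℕ) (s : State N K)
    (c : Fin N → Fin K → ℝ) : Fin N → ℝ :=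
  payment φ (slotAssign R τ s c) s.lam (ucb τ s) c

/-- Payoff-maximizing decisions: an agent follows the proposal iff the payment covers the cost. -/
def slotDecision {N K : ℕ} {φ : Fin N → ℝ} (R : AssignmentRule K φ) (τ : ℕ) (s : State N K)
    (c : Fin N → Fin K → ℝ) (n : Fin N) : ℝ :=
  if 0 ≤ slotPay R τ s c n - ∑ k, c n k * slotAssign R τ s c n k then 1 else 0

/-- State update at the end of slot number `τ`, with realized rewards `r` and costs `c`. The
gradient of the Lagrangian in the multiplier of agent `n` is `φ n - util x 1 n`. -/
def nextState {N K : ℕ} {φ : Fin N → ℝ} (η : ℝ) (R : AssignmentRule K φ) (τ : ℕ)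
    (s : State N K) (r : Fin K → ℝ) (c : Fin N → Fin K → ℝ) : State N K :=
  let x := slotAssign R τ s c
  let a := slotDecision R τ s c
  let h : Fin K → ℝ := fun k => s.count k + ∑ n, x n k * a n
  { lam := fun n => max (s.lam n - η * (φ n - util x 1 n)) 0
    count := h
    avg := fun k => (s.avg k * s.count k + r k * ∑ n, x n k * a n) / h k }

/-- State of the mechanism after `t` slots along a path of rewards and costs. Slots are indexed
from `0`, so that index `t` is slot number `t + 1`. -/
def state {N K : ℕ} {φ : Fin N → ℝ} (η : ℝ) (R : AssignmentRule K φ) (r : ℕ → Fin K → ℝ)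
    (c : ℕ → Fin N → Fin K → ℝ) : ℕ → State N K
  | 0 => ⟨fun _ => 0, fun _ => 0, fun _ => 0⟩
  | t + 1 => nextState η R (t + 1) (state η R r c t) (r t) (c t)

/-- Assignment in the slot of index `t`. -/
def xhat {N K : ℕ} {φ : Fin N → ℝ} (η : ℝ) (R : AssignmentRule K φ) (r : ℕ → Fin K → ℝ)
    (c : ℕ → Fin N → Fin K → ℝ) (t : ℕ) : Fin N → Fin K → ℝ :=
  slotAssign R (t + 1) (state η R r c t) (c t)

/-- Payments in the slot of index `t`. -/
def yhat {N K : ℕ} {φ : Fin N → ℝ} (η : ℝ) (R : AssignmentRule K φ) (r : ℕ → Fin K → ℝ)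
    (c : ℕ → Fin N → Fin K → ℝ) (t : ℕ) : Fin N → ℝ :=
  slotPay R (t + 1) (state η R r c t) (c t)

/-- Decisions in the slot of index `t`. -/
def ahat {N K : ℕ} {φ : Fin N → ℝ} (η : ℝ) (R : AssignmentRule K φ) (r : ℕ → Fin K → ℝ)
    (c : ℕ → Fin N → Fin K → ℝ) (t : ℕ) : Fin N → ℝ :=
  slotDecision R (t + 1) (state η R r c t) (c t)

/-- The random environment: IID reward vectors in `[0,1]^K` over the slots, and cost vectors in
`[cmin,1]^K` that are IID over agents and slots, rewards and costs being independent. The rewards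
(or costs) of different arms within one vector may have different laws and may be dependent. -/
structure Environment (Ω : Type*) [MeasurableSpace Ω] (μ : Measure Ω) (N K : ℕ) (cmin : ℝ) where
  /-- reward vector of each slot -/
  r : ℕ → Ω → Fin K → ℝ
  /-- cost vector of each agent in each slot -/
  c : ℕ → Fin N → Ω → Fin K → ℝ
  measurable_r : ∀ t, Measurable (r t)
  measurable_c : ∀ t n, Measurable (c t n)
  r_mem : ∀ t ω k, r t ω k ∈ Set.Icc (0 : ℝ) 1
  c_mem : ∀ t n ω k, c t n ω k ∈ Set.Icc cmin 1
  r_ident : ∀ t t', IdentDistrib (r t) (r t') μ μ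
  c_ident : ∀ t n t' n', IdentDistrib (c t n) (c t' n') μ μ
  indep : iIndepFun
    (fun i : ℕ ⊕ (ℕ × Fin N) => Sum.elim r (fun p : ℕ × Fin N => c p.1 p.2) i) μ

section Performance

variable {Ω : Type*} [MeasurableSpace Ω] {μ : Measure Ω} {N K : ℕ} {cmin : ℝ}

/-- Reward path of an outcome. -/
def Environment.rPath (E : Environment Ω μ N K cmin) (ω : Ω) : ℕ → Fin K → ℝ :=
  fun t => E.r t ω

/-- Cost path of an outcome. -/
def Environment.cPath (E : Environment Ω μ N K cmin) (ω : Ω) : ℕ → Fin N → Fin K → ℝ :=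
  fun t n => E.c t n ω

/-- Average reward of each arm. -/
def Environment.rbar (E : Environment Ω μ N K cmin) (k : Fin K) : ℝ :=
  ∫ ω, E.r 0 ω k ∂μ

/-- Law of the cost matrix of one slot. -/
def Environment.costLaw (E : Environment Ω μ N K cmin) : Measure (Fin N → Fin K → ℝ) :=
  μ.map (fun ω => E.cPath ω 0)

/-- The benchmark `S*`: the best expected welfare of a policy mapping the disclosed costs to
assignments and obeying the utilization caps on average, with known average rewards. -/
def Environment.benchmark (E : Environment Ω μ N K cmin) (φ : Fin N → ℝ) : ℝ :=
  sSup {v | ∃ x : (Fin N → Fin K → ℝ) → (Fin N → Fin K → ℝ), Measurable x ∧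
    (∀ c, x c ∈ assignments N K) ∧
    (∀ n, ∫ c, util (x c) 1 n ∂E.costLaw ≤ φ n) ∧
    v = ∫ c, ∑ k, ∑ n, (E.rbar k - c n k) * x c n k ∂E.costLaw}

/-- The upper bound `S†`: the best welfare of arm selection probabilities when every pull costs
`cmin`. -/
def Environment.upperBound (E : Environment Ω μ N K cmin) (φ : Fin N → ℝ) : ℝ :=
  sSup {v | ∃ p : Fin K → ℝ, (∀ k, p k ∈ Set.Icc (0 : ℝ) 1) ∧ ∑ k, p k ≤ ∑ n, φ n ∧
    v = ∑ k, (E.rbar k - cmin) * p k}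

/-- Expected welfare in the slot of index `t` under the mechanism. -/
def expWelfare (E : Environment Ω μ N K cmin) {φ : Fin N → ℝ} (η : ℝ) (R : AssignmentRule K φ)
    (t : ℕ) : ℝ :=
  ∫ ω, welfare (xhat η R (E.rPath ω) (E.cPath ω) t) (ahat η R (E.rPath ω) (E.cPath ω) t)
    (E.rPath ω t) (E.cPath ω t) ∂μ

/-- Cumulative degradation after `T` slots. -/
def Deg (E : Environment Ω μ N K cmin) {φ : Fin N → ℝ} (η : ℝ) (R : AssignmentRule K φ)
    (T : ℕ) : ℝ :=
  ∑ t ∈ Finset.range T, (E.upperBound φ - expWelfare E η R t)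

/-- Cumulative regret after `T` slots. -/
def Reg (E : Environment Ω μ N K cmin) {φ : Fin N → ℝ} (η : ℝ) (R : AssignmentRule K φ)
    (T : ℕ) : ℝ :=
  ∑ t ∈ Finset.range T, (E.benchmark φ - expWelfare E η R t)

/-- Cumulative fairness violation after `T` slots. -/
def Vio (E : Environment Ω μ N K cmin) {φ : Fin N → ℝ} (η : ℝ) (R : AssignmentRule K φ)
    (T : ℕ) : ℝ :=
  ∑ n, ∫ ω, max (∑ t ∈ Finset.range T,
    (util (xhat η R (E.rPath ω) (E.cPath ω) t) (ahat η R (E.rPath ω) (E.cPath ω) t) n - φ n)) 0 ∂μ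

/-- Cumulative profit of the principal after `T` slots. -/
def Pro (E : Environment Ω μ N K cmin) {φ : Fin N → ℝ} (η : ℝ) (R : AssignmentRule K φ)
    (T : ℕ) : ℝ :=
  ∑ t ∈ Finset.range T, ∫ ω,
    (reward (xhat η R (E.rPath ω) (E.cPath ω) t) (ahat η R (E.rPath ω) (E.cPath ω) t)
        (E.rPath ω t)
      - ∑ n, ahat η R (E.rPath ω) (E.cPath ω) t n * yhat η R (E.rPath ω) (E.cPath ω) t n) ∂μ

/-- `cmin` is the potential minimal cost: near `cmin`, the cost of every arm has at least linearly
growing probability (for instance, a density that is at least `κ` on `[cmin,1]`). -/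
def Environment.LinearMass (E : Environment Ω μ N K cmin) (κ : ℝ) : Prop :=
  ∀ t n k, ∀ s ∈ Set.Icc (0 : ℝ) (1 - cmin), κ * s ≤ μ.real {ω | E.c t n ω k ≤ cmin + s}

end Performance

/-- The step size of the mechanism for `K` arms, horizon `T` and caps `φ`. -/
def stepSize {N : ℕ} (K T : ℕ) (φ : Fin N → ℝ) : ℝ :=
  (4 * K + 2 * √(6 * K * T * (∑ n, φ n) * Real.log T)) / (T * min (K + ∑ n, φ n) (N : ℝ))

/-- The common utilization cap `α / N` of the agents in the homogeneous system. -/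
def crowdCap (α : ℝ) (N : ℕ) : Fin N → ℝ := fun _ => α / N

end IOL

end

/-!
The mechanism is a VCG auction for the Lagrangian with estimated rewards. The payoff of an agent
that follows the proposal is the maximum of the Lagrangian minus its maximum without the agent,
and the latter does not depend on the agent's bid (`payment_sub_cost`). Hence truthful bidding is
dominant and an obedient truthful agent never loses (`truthfulDominant`, `slotDecision_eq_one`),
so that all proposals are followed.

The welfare is controlled by comparing, slot by slot, the maximal Lagrangian with its value at
some competitor. Whenever the expected Lagrangian of the mechanism is at least `v` up to the
underestimation of the rewards, the accumulated shortfall of the welfare from `v` is bounded by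
three terms (`sum_sub_expWelfare_le`): the underestimation of the rewards, summable over time
because the confidence bounds fail with probability at most `1 / t ^ 2`; the drift of the squared
norm of the multipliers, which is where the step size enters (`neg_sum_lam_mul_le`); and the
overestimation of the pulled arms (`overestimation_le`). The last is a sum of confidence widths
`√(log T / H)` over the pulls, at most of order `√(K log T · number of pulls)`. The number of
pulls is `α T` plus the excess utilization, and the latter is bounded along every path: an agent
whose multiplier exceeds `1` is not used (`util_eq_zero_of_one_lt`), so multipliers are at most
`1 + η`, and the excess of an agent is at most its multiplier divided by `η` (`sum_util_sub_le`).
This also bounds the violation, by a multiple of `N / η = O(T ^ (β + 1/2))`, and the profit is at least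
minus the overestimation because an agent is paid no more than the estimated reward. Since pulls
are chosen adaptively, the confidence bounds come from Hoeffding's exponential supermartingale and
a union bound over the number of observations (`integral_expProcess_le_one`,
`measureReal_offEvent_le`).

Two competitors are used. A policy that obeys the caps on average gives the regret bound, as the
multipliers are independent of the costs of the slot (`policy_le_slotLagrangian`). The degradation
cannot be deduced from the regret: the benchmark policies are deterministic, and if the costs have
atoms, the benchmark can stay far below the upper bound. Instead, the arms are pulled with the
probabilities `p` of the upper bound by the cheapest agents of groups of size `N / K` that rotate
over all agents (`probabilities_le_slotLagrangian`); the least of `M` costs exceeds the minimal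
cost by at most `1 / (κ M)` on average (`integral_min_cost_le`), a loss of order `α T · K / (κ N)`
in total.
-/

namespace IOL

/-! ### The auction -/

section Auction

variable {N K : ℕ} {φ : Fin N → ℝ}

lemma zero_mem_assignments : (0 : Fin N → Fin K → ℝ) ∈ assignments N K := by
  simp [assignments]

lemma assignments_finite (N K : ℕ) : (assignments N K).Finite := by
  have h : (Set.univ.pi fun _ : Fin N => Set.univ.pi fun _ : Fin K => ({0, 1} : Set ℝ)).Finite :=
    Set.Finite.pi fun _ => Set.Finite.pi fun _ => Set.toFinite _
  refine h.subset fun x hx => ?_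
  simp only [Set.mem_pi, Set.mem_univ, forall_true_left, Set.mem_insert_iff, Set.mem_singleton_iff]
  exact hx.1

lemma assignments_nonneg {x : Fin N → Fin K → ℝ} (hx : x ∈ assignments N K) (n : Fin N)
    (k : Fin K) : 0 ≤ x n k := by
  rcases hx.1 n k with h | h <;> simp [h]

lemma assignments_le_one {x : Fin N → Fin K → ℝ} (hx : x ∈ assignments N K) (n : Fin N)
    (k : Fin K) : x n k ≤ 1 := by
  rcases hx.1 n k with h | h <;> simp [h]

lemma update_zero_mem_assignments {x : Fin N → Fin K → ℝ} (hx : x ∈ assignments N K) (n : Fin N) :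
    Function.update x n 0 ∈ assignments N K := by
  have hle : ∀ i k, Function.update x n 0 i k ≤ x i k := by
    intro i k
    by_cases h : i = n
    · subst h; simpa using assignments_nonneg hx i k
    · simp [h]
  refine ⟨fun i k => ?_, fun i => ?_, fun k => ?_⟩
  · by_cases h : i = n
    · subst h; simp
    · simpa [h] using hx.1 i k
  · exact (Finset.sum_le_sum fun k _ => hle i k).trans (hx.2.1 i)
  · exact (Finset.sum_le_sum fun i _ => hle i k).trans (hx.2.2 k)

lemma util_one (x : Fin N → Fin K → ℝ) (n : Fin N) : util x 1 n = ∑ k, x n k := by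
  simp [util]

lemma util_one_nonneg {x : Fin N → Fin K → ℝ} (hx : x ∈ assignments N K) (n : Fin N) :
    0 ≤ util x 1 n := by
  rw [util_one]; exact Finset.sum_nonneg fun k _ => assignments_nonneg hx n k

lemma util_one_le_one {x : Fin N → Fin K → ℝ} (hx : x ∈ assignments N K) (n : Fin N) :
    util x 1 n ≤ 1 := by
  rw [util_one]; exact hx.2.1 n

lemma welfare_one_eq (x : Fin N → Fin K → ℝ) (r : Fin K → ℝ) (c : Fin N → Fin K → ℝ) :
    welfare x 1 r c = ∑ n, ∑ k, (r k - c n k) * x n k := by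
  unfold welfare reward cost
  rw [Finset.sum_comm, ← Finset.sum_sub_distrib]
  refine Finset.sum_congr rfl fun n _ => ?_
  rw [← Finset.sum_sub_distrib]
  exact Finset.sum_congr rfl fun k _ => by simp; ring

lemma lagrangian_eq (x : Fin N → Fin K → ℝ) (lam : Fin N → ℝ) (r : Fin K → ℝ)
    (c : Fin N → Fin K → ℝ) :
    lagrangian φ x lam r c
      = ∑ n, ∑ k, (r k - c n k - lam n) * x n k + ∑ n, lam n * φ n := by
  unfold lagrangian
  rw [welfare_one_eq, ← Finset.sum_sub_distrib, ← Finset.sum_add_distrib]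
  refine Finset.sum_congr rfl fun n _ => ?_
  rw [util_one, mul_sub, Finset.mul_sum, sub_sub_eq_add_sub, add_sub_right_comm,
    ← Finset.sum_sub_distrib]
  congr 1
  exact Finset.sum_congr rfl fun k _ => by ring

lemma lagrangianWithout_eq (n : Fin N) (x : Fin N → Fin K → ℝ) (lam : Fin N → ℝ) (r : Fin K → ℝ)
    (c : Fin N → Fin K → ℝ) :
    lagrangianWithout φ n x lam r c
      = ∑ i ∈ Finset.univ.erase n, ∑ k, (r k - c i k - lam i) * x i k + ∑ i, lam i * φ i := by
  unfold lagrangianWithout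
  rw [Finset.sum_comm, ← Finset.sum_sub_distrib]
  congr 1
  refine Finset.sum_congr rfl fun i _ => ?_
  rw [util_one, Finset.mul_sum, ← Finset.sum_sub_distrib]
  exact Finset.sum_congr rfl fun k _ => by ring

/-- The contribution of agent `n` to the Lagrangian is separate from that of the other agents. -/
lemma lagrangian_eq_add_lagrangianWithout (n : Fin N) (x : Fin N → Fin K → ℝ) (lam : Fin N → ℝ)
    (r : Fin K → ℝ) (c : Fin N → Fin K → ℝ) :
    lagrangian φ x lam r c
      = ∑ k, (r k - c n k - lam n) * x n k + lagrangianWithout φ n x lam r c := by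
  rw [lagrangian_eq, lagrangianWithout_eq,
    ← Finset.add_sum_erase _ _ (Finset.mem_univ n), add_assoc]

lemma lagrangianWithout_update_bid (n : Fin N) (x : Fin N → Fin K → ℝ) (lam : Fin N → ℝ)
    (r : Fin K → ℝ) (bid : Fin N → Fin K → ℝ) (γ : Fin K → ℝ) :
    lagrangianWithout φ n x lam r (Function.update bid n γ)
      = lagrangianWithout φ n x lam r bid := by
  rw [lagrangianWithout_eq, lagrangianWithout_eq]
  congr 1
  refine Finset.sum_congr rfl fun i hi => ?_
  rw [Function.update_of_ne (Finset.ne_of_mem_erase hi)]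

lemma lagrangian_update_zero (n : Fin N) (x : Fin N → Fin K → ℝ) (lam : Fin N → ℝ)
    (r : Fin K → ℝ) (c : Fin N → Fin K → ℝ) :
    lagrangian φ (Function.update x n 0) lam r c = lagrangianWithout φ n x lam r c := by
  rw [lagrangian_eq_add_lagrangianWithout n, lagrangianWithout_eq, lagrangianWithout_eq]
  simp only [Function.update_self, Pi.zero_apply, mul_zero, Finset.sum_const_zero, zero_add]
  congr 1
  refine Finset.sum_congr rfl fun i hi => ?_
  rw [Function.update_of_ne (Finset.ne_of_mem_erase hi)]

/-- The payoff of an agent with cost vector `γ` that follows the proposal `x` is the excess of the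
Lagrangian over its maximum without the agent; the latter is not affected by the agent's bid. -/
lemma payment_sub_cost (n : Fin N) (x : Fin N → Fin K → ℝ) (lam : Fin N → ℝ) (rh : Fin K → ℝ)
    (bid : Fin N → Fin K → ℝ) (γ : Fin K → ℝ) :
    payment φ x lam rh bid n - ∑ k, γ k * x n k
      = lagrangian φ x lam rh (Function.update bid n γ) - lagrangianWithoutMax φ n lam rh bid := by
  rw [lagrangian_eq_add_lagrangianWithout n, lagrangianWithout_update_bid]
  unfold payment
  have : ∑ k, (rh k - Function.update bid n γ n k - lam n) * x n k
      = ∑ k, (rh k - lam n) * x n k - ∑ k, γ k * x n k := by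
    rw [← Finset.sum_sub_distrib]
    exact Finset.sum_congr rfl fun k _ => by rw [Function.update_self]; ring
  rw [this]; ring

lemma lagrangianWithoutMax_update_bid (n : Fin N) (lam : Fin N → ℝ)
    (r : Fin K → ℝ) (bid : Fin N → Fin K → ℝ) (γ : Fin K → ℝ) :
    lagrangianWithoutMax φ n lam r (Function.update bid n γ)
      = lagrangianWithoutMax φ n lam r bid := by
  simp only [lagrangianWithoutMax, lagrangianWithout_update_bid]

lemma lagrangianWithoutMax_le_sel (R : AssignmentRule K φ) (n : Fin N) (lam : Fin N → ℝ)
    (r : Fin K → ℝ) (bid : Fin N → Fin K → ℝ) :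
    lagrangianWithoutMax φ n lam r bid ≤ lagrangian φ (R.sel lam r bid) lam r bid := by
  refine csSup_le (Set.Nonempty.image _ ⟨0, zero_mem_assignments⟩) ?_
  rintro _ ⟨x, hx, rfl⟩
  change lagrangianWithout φ n x lam r bid ≤ _
  rw [← lagrangian_update_zero]
  exact R.sel_max _ _ _ _ (update_zero_mem_assignments hx n)

lemma lagrangianWithout_le_max (n : Fin N) {x : Fin N → Fin K → ℝ} (hx : x ∈ assignments N K)
    (lam : Fin N → ℝ) (r : Fin K → ℝ) (bid : Fin N → Fin K → ℝ) :
    lagrangianWithout φ n x lam r bid ≤ lagrangianWithoutMax φ n lam r bid :=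
  le_csSup ((assignments_finite N K).image _).bddAbove (Set.mem_image_of_mem _ hx)

lemma payment_le (n : Fin N) {x : Fin N → Fin K → ℝ} (hx : x ∈ assignments N K)
    (lam : Fin N → ℝ) (r : Fin K → ℝ) (bid : Fin N → Fin K → ℝ) :
    payment φ x lam r bid n ≤ ∑ k, (r k - lam n) * x n k := by
  have := lagrangianWithout_le_max (φ := φ) n hx lam r bid
  unfold payment; linarith

theorem truthfulDominant (R : AssignmentRule K φ) : TruthfulDominant R := by
  intro lam rh bid n γ d hd
  unfold auctionPayoff
  rw [payment_sub_cost, payment_sub_cost, Function.update_idem, lagrangianWithoutMax_update_bid,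
    mul_one]
  have h0 := lagrangianWithoutMax_le_sel R n lam rh (Function.update bid n γ)
  rw [lagrangianWithoutMax_update_bid] at h0
  have h1 := R.sel_max lam rh (Function.update bid n γ) _ (R.sel_mem lam rh bid)
  rcases hd with rfl | rfl
  · linarith
  · linarith

theorem slotDecision_eq_one (R : AssignmentRule K φ) (τ : ℕ) (s : State N K)
    (c : Fin N → Fin K → ℝ) (n : Fin N) : slotDecision R τ s c n = 1 := by
  unfold slotDecision slotPay
  rw [if_pos]
  rw [payment_sub_cost, Function.update_eq_self, sub_nonneg]
  exact lagrangianWithoutMax_le_sel R n _ _ _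

end Auction

/-! ### Sample paths of the mechanism -/

section Paths

variable {N K : ℕ} {φ : Fin N → ℝ} (η : ℝ) (R : AssignmentRule K φ) (r : ℕ → Fin K → ℝ)
  (c : ℕ → Fin N → Fin K → ℝ)

lemma ahat_eq_one (t : ℕ) : ahat η R r c t = 1 := by
  funext n; exact slotDecision_eq_one R _ _ _ n

lemma xhat_mem (t : ℕ) : xhat η R r c t ∈ assignments N K := R.sel_mem _ _ _

/-- Estimated rewards in the slot of index `t`. -/
noncomputable def rhat (t : ℕ) : Fin K → ℝ := ucb (t + 1) (state η R r c t)

/-- Indicator that an arm is pulled in the slot of index `t`. -/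
noncomputable def pull (t : ℕ) (k : Fin K) : ℝ := ∑ n, xhat η R r c t n k

lemma lam_succ (t : ℕ) (n : Fin N) : (state η R r c (t + 1)).lam n
    = max ((state η R r c t).lam n - η * (φ n - util (xhat η R r c t) 1 n)) 0 := rfl

lemma count_succ (t : ℕ) (k : Fin K) : (state η R r c (t + 1)).count k
    = (state η R r c t).count k + pull η R r c t k := by
  simp [state, nextState, pull, xhat, slotDecision_eq_one]

lemma avg_succ (t : ℕ) (k : Fin K) : (state η R r c (t + 1)).avg k
    = ((state η R r c t).avg k * (state η R r c t).count k + r t k * pull η R r c t k)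
      / (state η R r c (t + 1)).count k := by
  simp [state, nextState, pull, xhat, slotDecision_eq_one]

lemma xhat_eq (t : ℕ) : xhat η R r c t = R.sel (state η R r c t).lam (rhat η R r c t) (c t) := rfl

lemma lagrangian_le_xhat (t : ℕ) {x : Fin N → Fin K → ℝ} (hx : x ∈ assignments N K) :
    lagrangian φ x (state η R r c t).lam (rhat η R r c t) (c t)
      ≤ lagrangian φ (xhat η R r c t) (state η R r c t).lam (rhat η R r c t) (c t) :=
  R.sel_max _ _ _ _ hx

/-- An assignment has entries in `{0, 1}`, so a column sum that is at most `1` is `0` or `1`. -/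
lemma sum_column_eq {x : Fin N → Fin K → ℝ} (hx : x ∈ assignments N K) (k : Fin K) :
    ∑ n, x n k = 0 ∨ ∑ n, x n k = 1 := by
  by_cases h : ∃ n, x n k = 1
  · obtain ⟨n, hn⟩ := h
    refine Or.inr (le_antisymm (hx.2.2 k) ?_)
    rw [← hn]
    exact Finset.single_le_sum (f := fun n => x n k) (fun i _ => assignments_nonneg hx i k)
      (Finset.mem_univ n)
  · push Not at h
    exact Or.inl (Finset.sum_eq_zero fun n _ => (hx.1 n k).resolve_right (h n))

lemma pull_eq (t : ℕ) (k : Fin K) : pull η R r c t k = 0 ∨ pull η R r c t k = 1 :=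
  sum_column_eq (xhat_mem η R r c t) k

lemma pull_nonneg (t : ℕ) (k : Fin K) : 0 ≤ pull η R r c t k := by
  rcases pull_eq η R r c t k with h | h <;> simp [h]

lemma count_eq_natCast (t : ℕ) (k : Fin K) :
    ∃ h : ℕ, h ≤ t ∧ (state η R r c t).count k = h := by
  induction t with
  | zero => exact ⟨0, le_rfl, by simp [state]⟩
  | succ t ih =>
    obtain ⟨h, hle, he⟩ := ih
    rw [count_succ, he]
    rcases pull_eq η R r c t k with hp | hp
    · exact ⟨h, by omega, by simp [hp]⟩
    · exact ⟨h + 1, by omega, by simp [hp]⟩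

lemma count_nonneg (t : ℕ) (k : Fin K) : 0 ≤ (state η R r c t).count k := by
  obtain ⟨h, -, he⟩ := count_eq_natCast η R r c t k
  rw [he]; positivity

lemma avg_mul_count_succ (t : ℕ) (k : Fin K) :
    (state η R r c (t + 1)).avg k * (state η R r c (t + 1)).count k
      = (state η R r c t).avg k * (state η R r c t).count k + r t k * pull η R r c t k := by
  rw [avg_succ]
  by_cases h : (state η R r c (t + 1)).count k = 0
  · -- the average of no observations is the junk value `x / 0`, but it is multiplied by `0`
    have h' := h
    rw [count_succ] at h'
    have h1 := count_nonneg η R r c t k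
    have h2 := pull_nonneg η R r c t k
    have h3 : (state η R r c t).count k = 0 := by linarith
    have h4 : pull η R r c t k = 0 := by linarith
    rw [h, h3, h4]; simp
  · rw [div_mul_cancel₀ _ h]

lemma lam_nonneg (t : ℕ) (n : Fin N) : 0 ≤ (state η R r c t).lam n := by
  cases t with
  | zero => simp [state]
  | succ t => rw [lam_succ]; exact le_max_right _ _

lemma avg_nonneg (hr : ∀ t k, 0 ≤ r t k) (t : ℕ) (k : Fin K) : 0 ≤ (state η R r c t).avg k := by
  induction t with
  | zero => simp [state]
  | succ t ih =>
    rw [avg_succ]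
    have := count_nonneg η R r c t k
    have := count_nonneg η R r c (t + 1) k
    have := pull_nonneg η R r c t k
    have := hr t k
    positivity

lemma rhat_nonneg (hr : ∀ t k, 0 ≤ r t k) (t : ℕ) (k : Fin K) : 0 ≤ rhat η R r c t k := by
  unfold rhat ucb
  split_ifs
  · exact zero_le_one
  · have := avg_nonneg η R r c hr t k
    exact le_min (by positivity) zero_le_one

lemma rhat_le_one (t : ℕ) (k : Fin K) : rhat η R r c t k ≤ 1 := by
  unfold rhat ucb
  split_ifs
  · exact le_rfl
  · exact min_le_right _ _

/-- An agent whose multiplier exceeds `1` is not used: the multiplier exceeds the gain. -/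
lemma util_eq_zero_of_one_lt (hc : ∀ t n k, 0 ≤ c t n k) (t : ℕ) (n : Fin N)
    (h : 1 < (state η R r c t).lam n) : util (xhat η R r c t) 1 n = 0 := by
  have hx := xhat_mem η R r c t
  have h1 := lagrangian_le_xhat η R r c t (update_zero_mem_assignments hx n)
  rw [lagrangian_update_zero, lagrangian_eq_add_lagrangianWithout n] at h1
  have h2 : ∑ k, (rhat η R r c t k - c t n k - (state η R r c t).lam n) * xhat η R r c t n k
      ≤ ∑ k, (1 - (state η R r c t).lam n) * xhat η R r c t n k := by
    refine Finset.sum_le_sum fun k _ => mul_le_mul_of_nonneg_right ?_ (assignments_nonneg hx n k)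
    have := rhat_le_one η R r c t k
    have := hc t n k
    linarith
  rw [← Finset.mul_sum, ← util_one] at h2
  have h3 := util_one_nonneg hx n
  by_contra h4
  have h5 : 0 < util (xhat η R r c t) 1 n := lt_of_le_of_ne h3 (Ne.symm h4)
  nlinarith

lemma lam_le (hη : 0 ≤ η) (hφ : ∀ n, 0 ≤ φ n) (hc : ∀ t n k, 0 ≤ c t n k) (t : ℕ) (n : Fin N) :
    (state η R r c t).lam n ≤ 1 + η := by
  induction t with
  | zero => simp [state]; linarith
  | succ t ih =>
    rw [lam_succ]
    have h1 := util_one_le_one (xhat_mem η R r c t) n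
    refine max_le ?_ (by linarith)
    rcases le_or_gt ((state η R r c t).lam n) 1 with h | h
    · nlinarith [hφ n, mul_nonneg hη (hφ n)]
    · rw [util_eq_zero_of_one_lt η R r c hc t n h]
      nlinarith [hφ n, mul_nonneg hη (hφ n)]

/-- The multiplier of an agent dominates its accumulated excess utilization. -/
lemma sum_util_sub_le (hη : 0 < η) (hφ : ∀ n, 0 ≤ φ n) (hc : ∀ t n k, 0 ≤ c t n k) (T : ℕ)
    (n : Fin N) :
    ∑ t ∈ Finset.range T, (util (xhat η R r c t) 1 n - φ n) ≤ (1 + η) / η := by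
  have key : η * ∑ t ∈ Finset.range T, (util (xhat η R r c t) 1 n - φ n)
      ≤ (state η R r c T).lam n := by
    induction T with
    | zero => simp [state]
    | succ T ih =>
      rw [Finset.sum_range_succ, lam_succ]
      refine le_trans ?_ (le_max_left _ _)
      linarith
  rw [le_div_iff₀ hη]
  linarith [lam_le η R r c hη.le hφ hc T n]

lemma sum_pull (t : ℕ) : ∑ k, pull η R r c t k = ∑ n, util (xhat η R r c t) 1 n := by
  simp only [pull, util_one]; exact Finset.sum_comm

lemma sum_count_le (hη : 0 < η) (hφ : ∀ n, 0 ≤ φ n) (hc : ∀ t n k, 0 ≤ c t n k) (T : ℕ) :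
    ∑ k, (state η R r c T).count k ≤ T * ∑ n, φ n + N * ((1 + η) / η) := by
  have h1 : ∀ T, ∑ k, (state η R r c T).count k
      = ∑ n, ∑ t ∈ Finset.range T, util (xhat η R r c t) 1 n := by
    intro T
    induction T with
    | zero => simp [state]
    | succ T ih =>
      simp only [count_succ, Finset.sum_range_succ, Finset.sum_add_distrib, ih, sum_pull]
  have h2 := Finset.sum_le_sum fun n (_ : n ∈ Finset.univ) =>
    sum_util_sub_le η R r c hη hφ hc T n
  simp only [Finset.sum_sub_distrib, Finset.sum_const, Finset.card_univ, Fintype.card_fin,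
    Finset.card_range, nsmul_eq_mul, ← Finset.mul_sum] at h2
  rw [h1]; linarith

lemma sum_sq_util_sub_le (hφ : ∀ n, φ n ∈ Set.Icc (0 : ℝ) 1) {x : Fin N → Fin K → ℝ}
    (hx : x ∈ assignments N K) : ∑ n, (util x 1 n - φ n) ^ 2 ≤ K + ∑ n, φ n := by
  have h1 : ∀ n, (util x 1 n - φ n) ^ 2 ≤ util x 1 n + φ n := by
    intro n
    have := util_one_nonneg hx n
    have := util_one_le_one hx n
    have := (hφ n).1
    have := (hφ n).2
    nlinarith [mul_nonneg (util_one_nonneg hx n) (hφ n).1]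
  refine (Finset.sum_le_sum fun n _ => h1 n).trans ?_
  rw [Finset.sum_add_distrib]
  have h2 : ∑ n, util x 1 n ≤ K := by
    simp only [util_one]
    rw [Finset.sum_comm]
    refine (Finset.sum_le_sum fun k _ => hx.2.2 k).trans ?_
    simp
  linarith

/-- Drift of the squared norm of the multipliers. -/
lemma neg_sum_lam_mul_le (hη : 0 < η) (hφ : ∀ n, φ n ∈ Set.Icc (0 : ℝ) 1) (T : ℕ) :
    -∑ t ∈ Finset.range T, ∑ n, (state η R r c t).lam n * (util (xhat η R r c t) 1 n - φ n)
      ≤ η * T * (K + ∑ n, φ n) / 2 := by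
  have key : ∀ T : ℕ, ∑ n, (state η R r c T).lam n ^ 2
      ≤ 2 * η * ∑ t ∈ Finset.range T,
          ∑ n, (state η R r c t).lam n * (util (xhat η R r c t) 1 n - φ n)
        + η ^ 2 * T * (K + ∑ n, φ n) := by
    intro T
    induction T with
    | zero => simp [state]
    | succ T ih =>
      have h1 : ∀ n, (state η R r c (T + 1)).lam n ^ 2 ≤ (state η R r c T).lam n ^ 2
          + 2 * η * ((state η R r c T).lam n * (util (xhat η R r c T) 1 n - φ n))
          + η ^ 2 * (util (xhat η R r c T) 1 n - φ n) ^ 2 := by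
        intro n
        have : (state η R r c (T + 1)).lam n ^ 2
            ≤ ((state η R r c T).lam n - η * (φ n - util (xhat η R r c T) 1 n)) ^ 2 := by
          rw [lam_succ]
          rcases le_total ((state η R r c T).lam n - η * (φ n - util (xhat η R r c T) 1 n)) 0
            with h | h
          · rw [max_eq_right h]; simpa using sq_nonneg _
          · rw [max_eq_left h]
        refine this.trans (le_of_eq (by ring))
      have h2 := Finset.sum_le_sum fun n (_ : n ∈ Finset.univ) => h1 n
      rw [Finset.sum_add_distrib, Finset.sum_add_distrib, ← Finset.mul_sum, ← Finset.mul_sum] at h2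
      have h3 := mul_le_mul_of_nonneg_left
        (sum_sq_util_sub_le (K := K) hφ (xhat_mem η R r c T)) (sq_nonneg η)
      rw [Finset.sum_range_succ]
      push_cast
      nlinarith
  have h1 := key T
  have h2 : 0 ≤ ∑ n, (state η R r c T).lam n ^ 2 := Finset.sum_nonneg fun n _ => sq_nonneg _
  set Y := ∑ t ∈ Finset.range T,
    ∑ n, (state η R r c t).lam n * (util (xhat η R r c t) 1 n - φ n)
  have h3 : 0 ≤ η * (2 * Y + η * T * (K + ∑ n, φ n)) := by nlinarith
  have h4 := nonneg_of_mul_nonneg_right h3 hη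
  linarith

/-- Summing a confidence width of `a / √h` over the pulls of an arm, `h` being the number of
earlier pulls; the first pull is charged `1`. -/
lemma sum_pull_mul_width_le {a : ℝ} (ha : 0 ≤ a) (T : ℕ) (k : Fin K) :
    ∑ t ∈ Finset.range T, pull η R r c t k *
        (if (state η R r c t).count k = 0 then 1 else a / √((state η R r c t).count k))
      ≤ 1 + 3 * a * √((state η R r c T).count k) := by
  have key : ∑ t ∈ Finset.range T, pull η R r c t k *
        (if (state η R r c t).count k = 0 then 1 else a / √((state η R r c t).count k))
      ≤ (if (state η R r c T).count k = 0 then 0 else 1)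
        + 3 * a * √((state η R r c T).count k) := by
    induction T with
    | zero => simp [state]
    | succ T ih =>
      rw [Finset.sum_range_succ]
      obtain ⟨h, -, he⟩ := count_eq_natCast η R r c T k
      rcases pull_eq η R r c T k with hp | hp
      · rw [count_succ, hp]; simpa using ih
      · rw [count_succ, hp]
        rw [he] at ih ⊢
        rcases Nat.eq_zero_or_pos h with rfl | hpos
        · simp at ih ⊢; linarith
        · have hh : (1 : ℝ) ≤ h := by exact_mod_cast hpos
          have h1 : (h : ℝ) + 1 ≠ 0 := (by linarith : (0 : ℝ) < h + 1).ne'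
          have h2 : (h : ℝ) ≠ 0 := (zero_lt_one.trans_le hh).ne'
          rw [if_neg h2] at ih ⊢
          rw [if_neg h1, one_mul]
          have hs : 0 < √(h : ℝ) := Real.sqrt_pos.mpr (by linarith)
          have hs1 : √(h : ℝ) ^ 2 = h := Real.sq_sqrt (by linarith)
          have hs2 : √((h : ℝ) + 1) ^ 2 = h + 1 := Real.sq_sqrt (by linarith)
          have hs3 : √((h : ℝ) + 1) ≤ 2 * √(h : ℝ) := by
            rw [show (2 : ℝ) * √(h : ℝ) = √(4 * h) by
              rw [Real.sqrt_mul (by norm_num), show (4 : ℝ) = 2 ^ 2 by norm_num,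
                Real.sqrt_sq (by norm_num)]]
            exact Real.sqrt_le_sqrt (by linarith)
          -- `1 = (√(h+1) - √h) (√(h+1) + √h)` and `√(h+1) + √h ≤ 3 √h`
          have h3 : a / √(h : ℝ) ≤ 3 * a * (√((h : ℝ) + 1) - √(h : ℝ)) := by
            rw [div_le_iff₀ hs]
            have h4 : √(h : ℝ) ≤ √((h : ℝ) + 1) := Real.sqrt_le_sqrt (by linarith)
            have h5 : 1 ≤ 3 * (√((h : ℝ) + 1) - √(h : ℝ)) * √(h : ℝ) := by nlinarith
            nlinarith
          linarith
  refine key.trans ?_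
  split_ifs <;> linarith

end Paths

/-! ### Bounded measurable functions -/

section Bounded

variable {Ω : Type*} [MeasurableSpace Ω]

/-- Bounded measurable real functions: they are integrable for every probability measure and closed
under the ring operations, so all integrability side conditions reduce to this predicate. -/
structure BddMeas (f : Ω → ℝ) : Prop where
  measurable : Measurable f
  bdd : ∃ C, ∀ ω, |f ω| ≤ C

namespace BddMeas

variable {f g : Ω → ℝ}

lemma of_mem_Icc {a b : ℝ} (hf : Measurable f) (h : ∀ ω, f ω ∈ Set.Icc a b) : BddMeas f :=
  ⟨hf, max |a| |b|, fun ω => abs_le_max_abs_abs (h ω).1 (h ω).2⟩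

lemma const (a : ℝ) : BddMeas (fun _ : Ω => a) := ⟨measurable_const, |a|, fun _ => le_rfl⟩

lemma add (hf : BddMeas f) (hg : BddMeas g) : BddMeas (fun ω => f ω + g ω) := by
  obtain ⟨A, hA⟩ := hf.bdd
  obtain ⟨B, hB⟩ := hg.bdd
  exact ⟨hf.measurable.add hg.measurable, A + B, fun ω =>
    (abs_add_le _ _).trans (add_le_add (hA ω) (hB ω))⟩

lemma neg (hf : BddMeas f) : BddMeas (fun ω => -f ω) := by
  obtain ⟨A, hA⟩ := hf.bdd
  exact ⟨hf.measurable.neg, A, fun ω => by simpa using hA ω⟩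

lemma sub (hf : BddMeas f) (hg : BddMeas g) : BddMeas (fun ω => f ω - g ω) := by
  simpa only [sub_eq_add_neg] using hf.add hg.neg

lemma mul (hf : BddMeas f) (hg : BddMeas g) : BddMeas (fun ω => f ω * g ω) := by
  obtain ⟨A, hA⟩ := hf.bdd
  obtain ⟨B, hB⟩ := hg.bdd
  refine ⟨hf.measurable.mul hg.measurable, A * B, fun ω => ?_⟩
  rw [abs_mul]
  exact mul_le_mul (hA ω) (hB ω) (abs_nonneg _) ((abs_nonneg _).trans (hA ω))

lemma sum {ι : Type*} (s : Finset ι) {F : ι → Ω → ℝ} (h : ∀ i ∈ s, BddMeas (F i)) :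
    BddMeas (fun ω => ∑ i ∈ s, F i ω) := by
  classical
  induction s using Finset.induction_on with
  | empty => simpa using const 0
  | insert i s hi ih =>
    simp only [Finset.sum_insert hi]
    exact (h i (Finset.mem_insert_self i s)).add
      (ih fun j hj => h j (Finset.mem_insert_of_mem hj))

lemma exp (hf : BddMeas f) : BddMeas (fun ω => Real.exp (f ω)) := by
  obtain ⟨A, hA⟩ := hf.bdd
  refine of_mem_Icc (a := 0) (b := Real.exp A) hf.measurable.exp fun ω => ⟨(Real.exp_pos _).le, ?_⟩
  exact Real.exp_le_exp.mpr ((le_abs_self _).trans (hA ω))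

lemma max_zero (hf : BddMeas f) : BddMeas (fun ω => max (f ω) 0) := by
  obtain ⟨A, hA⟩ := hf.bdd
  refine of_mem_Icc (a := 0) (b := A) (hf.measurable.max measurable_const) fun ω =>
    ⟨le_max_right _ _, max_le ((le_abs_self _).trans (hA ω)) ((abs_nonneg _).trans (hA ω))⟩

lemma integrable (hf : BddMeas f) (μ : Measure Ω) [IsFiniteMeasure μ] : Integrable f μ := by
  obtain ⟨A, hA⟩ := hf.bdd
  exact Integrable.of_bound hf.measurable.aestronglyMeasurable A (ae_of_all _ hA)

end BddMeas

end Bounded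

/-! ### Measurability and independence along the mechanism -/

section Measurability

variable {Ω : Type*} [MeasurableSpace Ω] {N K : ℕ} {φ : Fin N → ℝ} (η : ℝ)
  (R : AssignmentRule K φ)

lemma measurable_ucb (τ : ℕ) {s : Ω → State N K} (h1 : Measurable fun ω => (s ω).count)
    (h2 : Measurable fun ω => (s ω).avg) : Measurable fun ω => ucb τ (s ω) := by
  rw [measurable_pi_iff] at h1 h2 ⊢
  intro k
  unfold ucb
  refine Measurable.ite (h1 k (measurableSet_singleton 0)) measurable_const ?_
  exact ((h2 k).add ((measurable_const.div ((h1 k).const_mul 2)).sqrt)).min measurable_const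

/-- The state after `t` slots is a measurable function of the rewards and costs of the first
`t` slots. -/
lemma measurable_state (r : Ω → ℕ → Fin K → ℝ) (c : Ω → ℕ → Fin N → Fin K → ℝ) (t : ℕ)
    (hr : ∀ s < t, Measurable fun ω => r ω s) (hc : ∀ s < t, Measurable fun ω => c ω s) :
    Measurable (fun ω => (state η R (r ω) (c ω) t).lam) ∧
    Measurable (fun ω => (state η R (r ω) (c ω) t).count) ∧
    Measurable (fun ω => (state η R (r ω) (c ω) t).avg) := by
  induction t with
  | zero => exact ⟨measurable_const, measurable_const, measurable_const⟩
  | succ t ih =>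
    obtain ⟨h1, h2, h3⟩ := ih (fun s hs => hr s (by omega)) (fun s hs => hc s (by omega))
    have hx : Measurable fun ω => xhat η R (r ω) (c ω) t :=
      R.measurable_sel.comp (h1.prodMk ((measurable_ucb (t + 1) h2 h3).prodMk (hc t (by omega))))
    have hx' : ∀ n k, Measurable fun ω => xhat η R (r ω) (c ω) t n k := fun n k =>
      (measurable_pi_apply k).comp ((measurable_pi_apply n).comp hx)
    have hp : ∀ k, Measurable fun ω => pull η R (r ω) (c ω) t k := fun k =>
      Finset.measurable_sum _ fun n _ => hx' n k
    have hr' := measurable_pi_iff.mp (hr t (by omega))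
    have hcount : ∀ k, Measurable fun ω => (state η R (r ω) (c ω) (t + 1)).count k := by
      intro k
      simp only [count_succ]
      exact (measurable_pi_iff.mp h2 k).add (hp k)
    refine ⟨measurable_pi_iff.mpr fun n => ?_, measurable_pi_iff.mpr hcount,
      measurable_pi_iff.mpr fun k => ?_⟩
    · simp only [lam_succ, util_one]
      exact ((measurable_pi_iff.mp h1 n).sub ((measurable_const.sub
        (Finset.measurable_sum _ fun k _ => hx' n k)).const_mul η)).max measurable_const
    · simp only [avg_succ]
      exact (((measurable_pi_iff.mp h3 k).mul (measurable_pi_iff.mp h2 k)).add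
        ((hr' k).mul (hp k))).div (hcount k)

lemma measurable_xhat (r : Ω → ℕ → Fin K → ℝ) (c : Ω → ℕ → Fin N → Fin K → ℝ) (t : ℕ)
    (hr : ∀ s < t, Measurable fun ω => r ω s) (hc : ∀ s < t + 1, Measurable fun ω => c ω s) :
    Measurable fun ω => xhat η R (r ω) (c ω) t := by
  obtain ⟨h1, h2, h3⟩ := measurable_state η R r c t hr fun s hs => hc s (by omega)
  exact R.measurable_sel.comp
    (h1.prodMk ((measurable_ucb (t + 1) h2 h3).prodMk (hc t (by omega))))

end Measurability

section Independence

variable {Ω : Type*} [MeasurableSpace Ω] {μ : Measure Ω} {N K : ℕ} {cmin : ℝ}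
  (E : Environment Ω μ N K cmin)

/-- The information carried by the observations with indices in `S`: index `inl t` stands for the
reward vector of slot `t`, index `inr (t, n)` for the cost vector of agent `n` in slot `t`. -/
@[reducible] def Environment.info (S : Set (ℕ ⊕ (ℕ × Fin N))) : MeasurableSpace Ω :=
  ⨆ i ∈ S, MeasurableSpace.comap
    (Sum.elim E.r (fun p : ℕ × Fin N => E.c p.1 p.2) i) inferInstance

lemma Environment.measurable_r_info {S : Set (ℕ ⊕ (ℕ × Fin N))} {t : ℕ} (h : Sum.inl t ∈ S) :
    Measurable[E.info S] (E.r t) :=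
  Measurable.mono (comap_measurable (E.r t))
    (le_biSup (fun i => MeasurableSpace.comap
      (Sum.elim E.r (fun p : ℕ × Fin N => E.c p.1 p.2) i) inferInstance) h) le_rfl

lemma Environment.measurable_c_info {S : Set (ℕ ⊕ (ℕ × Fin N))} {t : ℕ} {n : Fin N}
    (h : Sum.inr (t, n) ∈ S) : Measurable[E.info S] (E.c t n) :=
  Measurable.mono (comap_measurable (E.c t n))
    (le_biSup (fun i => MeasurableSpace.comap
      (Sum.elim E.r (fun p : ℕ × Fin N => E.c p.1 p.2) i) inferInstance) h) le_rfl

lemma Environment.indepFun_of_disjoint {β γ : Type*} [MeasurableSpace β] [MeasurableSpace γ]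
    {S T : Set (ℕ ⊕ (ℕ × Fin N))} (hST : Disjoint S T) {f : Ω → β} {g : Ω → γ}
    (hf : Measurable[E.info S] f) (hg : Measurable[E.info T] g) : IndepFun f g μ := by
  rw [IndepFun_iff_Indep]
  have h := indep_iSup_of_disjoint (μ := μ) (fun i => Measurable.comap_le (by
    rcases i with t | ⟨t, n⟩
    · exact E.measurable_r t
    · exact E.measurable_c t n)) ((iIndepFun_iff_iIndep _ _ _).mp E.indep) hST
  exact indep_of_indep_of_le_left (indep_of_indep_of_le_right h hg.comap_le) hf.comap_le

/-- Indices of the observations made before slot `t`. -/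
def past (N t : ℕ) : Set (ℕ ⊕ (ℕ × Fin N)) := {i | Sum.elim (· < t) (fun p => p.1 < t) i}

/-- Indices of the costs of slot `t`. -/
def costIdx (N t : ℕ) : Set (ℕ ⊕ (ℕ × Fin N)) :=
  {i | Sum.elim (fun _ => False) (fun p => p.1 = t) i}

lemma disjoint_past_costIdx (t : ℕ) : Disjoint (past N t) (costIdx N t) := by
  rw [Set.disjoint_left]
  rintro (s | ⟨s, n⟩) h1 h2
  · exact h2
  · simp only [past, costIdx, Set.mem_ofPred_eq, Sum.elim_inr] at h1 h2
    omega

lemma disjoint_past_union_costIdx_reward (t : ℕ) :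
    Disjoint (past N t ∪ costIdx N t) {Sum.inl t} := by
  rw [Set.disjoint_singleton_right]
  rintro (h | h)
  · exact lt_irrefl t h
  · exact h

lemma Environment.measurable_cPath_info {S : Set (ℕ ⊕ (ℕ × Fin N))} {s : ℕ}
    (h : ∀ n, Sum.inr (s, n) ∈ S) : Measurable[E.info S] fun ω => E.cPath ω s :=
  @measurable_pi_lambda _ _ _ (E.info S) _ _ fun n => E.measurable_c_info (h n)

variable {φ : Fin N → ℝ} (η : ℝ) (R : AssignmentRule K φ)

lemma measurable_state_past (t : ℕ) :
    Measurable[E.info (past N t)] (fun ω => (state η R (E.rPath ω) (E.cPath ω) t).lam) ∧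
    Measurable[E.info (past N t)] (fun ω => (state η R (E.rPath ω) (E.cPath ω) t).count) ∧
    Measurable[E.info (past N t)] (fun ω => (state η R (E.rPath ω) (E.cPath ω) t).avg) :=
  @measurable_state Ω (E.info (past N t)) N K φ η R E.rPath E.cPath t
    (fun _ hs => E.measurable_r_info hs) (fun _ hs => E.measurable_cPath_info fun _ => hs)

lemma measurable_state_past_union (t : ℕ) :
    Measurable[E.info (past N t ∪ costIdx N t)]
      (fun ω => (state η R (E.rPath ω) (E.cPath ω) t).lam) ∧
    Measurable[E.info (past N t ∪ costIdx N t)]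
      (fun ω => (state η R (E.rPath ω) (E.cPath ω) t).count) ∧
    Measurable[E.info (past N t ∪ costIdx N t)]
      (fun ω => (state η R (E.rPath ω) (E.cPath ω) t).avg) :=
  @measurable_state Ω (E.info (past N t ∪ costIdx N t)) N K φ η R E.rPath E.cPath t
    (fun _ hs => E.measurable_r_info (Or.inl hs))
    (fun _ hs => E.measurable_cPath_info fun _ => Or.inl hs)

lemma measurable_xhat_past_union (t : ℕ) :
    Measurable[E.info (past N t ∪ costIdx N t)]
      (fun ω => xhat η R (E.rPath ω) (E.cPath ω) t) :=
  @measurable_xhat Ω (E.info (past N t ∪ costIdx N t)) N K φ η R E.rPath E.cPath t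
    (fun _ hs => E.measurable_r_info (Or.inl hs))
    (fun s hs => E.measurable_cPath_info fun _ => by
      rcases Nat.lt_succ_iff_lt_or_eq.mp hs with h | h
      · exact Or.inl h
      · exact Or.inr h)

lemma Environment.measurable_cPath (s : ℕ) : Measurable fun ω => E.cPath ω s :=
  measurable_pi_lambda _ fun n => E.measurable_c s n

lemma measurable_state_env (t : ℕ) :
    Measurable (fun ω => (state η R (E.rPath ω) (E.cPath ω) t).lam) ∧
    Measurable (fun ω => (state η R (E.rPath ω) (E.cPath ω) t).count) ∧
    Measurable (fun ω => (state η R (E.rPath ω) (E.cPath ω) t).avg) :=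
  measurable_state η R E.rPath E.cPath t (fun s _ => E.measurable_r s)
    (fun s _ => E.measurable_cPath s)

lemma measurable_xhat_env (t : ℕ) : Measurable fun ω => xhat η R (E.rPath ω) (E.cPath ω) t :=
  measurable_xhat η R E.rPath E.cPath t (fun s _ => E.measurable_r s)
    (fun s _ => E.measurable_cPath s)

lemma bddMeas_xhat (t : ℕ) (n : Fin N) (k : Fin K) :
    BddMeas fun ω => xhat η R (E.rPath ω) (E.cPath ω) t n k :=
  BddMeas.of_mem_Icc ((measurable_pi_apply k).comp ((measurable_pi_apply n).comp
    (measurable_xhat_env E η R t))) fun _ =>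
      ⟨assignments_nonneg (xhat_mem η R _ _ t) n k, assignments_le_one (xhat_mem η R _ _ t) n k⟩

lemma bddMeas_pull (t : ℕ) (k : Fin K) :
    BddMeas fun ω => pull η R (E.rPath ω) (E.cPath ω) t k :=
  BddMeas.sum _ fun n _ => bddMeas_xhat E η R t n k

lemma bddMeas_util (t : ℕ) (n : Fin N) :
    BddMeas fun ω => util (xhat η R (E.rPath ω) (E.cPath ω) t) 1 n := by
  simp only [util_one]
  exact BddMeas.sum _ fun k _ => bddMeas_xhat E η R t n k

lemma bddMeas_rhat (t : ℕ) (k : Fin K) :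
    BddMeas fun ω => rhat η R (E.rPath ω) (E.cPath ω) t k := by
  obtain ⟨-, h2, h3⟩ := measurable_state_env E η R t
  exact BddMeas.of_mem_Icc (measurable_pi_iff.mp (measurable_ucb (t + 1) h2 h3) k) fun ω =>
    ⟨rhat_nonneg η R _ _ (fun s k => (E.r_mem s ω k).1) t k, rhat_le_one η R _ _ t k⟩

lemma bddMeas_count (t : ℕ) (k : Fin K) :
    BddMeas fun ω => (state η R (E.rPath ω) (E.cPath ω) t).count k := by
  refine BddMeas.of_mem_Icc (a := 0) (b := t)
    (measurable_pi_iff.mp (measurable_state_env E η R t).2.1 k) fun ω =>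
      ⟨count_nonneg η R _ _ t k, ?_⟩
  obtain ⟨h, hle, he⟩ := count_eq_natCast η R (E.rPath ω) (E.cPath ω) t k
  rw [he]; exact_mod_cast hle

lemma bddMeas_r (t : ℕ) (k : Fin K) : BddMeas fun ω => E.r t ω k :=
  BddMeas.of_mem_Icc ((measurable_pi_apply k).comp (E.measurable_r t)) fun ω => E.r_mem t ω k

lemma bddMeas_c (t : ℕ) (n : Fin N) (k : Fin K) : BddMeas fun ω => E.c t n ω k :=
  BddMeas.of_mem_Icc ((measurable_pi_apply k).comp (E.measurable_c t n)) fun ω => E.c_mem t n ω k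

lemma bddMeas_lam (hη : 0 ≤ η) (hφ : ∀ n, 0 ≤ φ n) (hcmin : 0 ≤ cmin) (t : ℕ) (n : Fin N) :
    BddMeas fun ω => (state η R (E.rPath ω) (E.cPath ω) t).lam n :=
  BddMeas.of_mem_Icc (measurable_pi_iff.mp (measurable_state_env E η R t).1 n) fun ω =>
    ⟨lam_nonneg η R _ _ t n,
      lam_le η R _ _ hη hφ (fun s n k => hcmin.trans (E.c_mem s n ω k).1) t n⟩

lemma bddMeas_avg_mul_count (t : ℕ) (k : Fin K) :
    BddMeas fun ω => (state η R (E.rPath ω) (E.cPath ω) t).avg k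
      * (state η R (E.rPath ω) (E.cPath ω) t).count k := by
  induction t with
  | zero => simpa [state] using BddMeas.const 0
  | succ t ih =>
    simp only [avg_mul_count_succ]
    exact ih.add ((bddMeas_r E t k).mul (bddMeas_pull E η R t k))

lemma Environment.integral_r (t : ℕ) (k : Fin K) : ∫ ω, E.r t ω k ∂μ = E.rbar k :=
  ((E.r_ident t 0).comp (measurable_pi_apply k)).integral_eq

lemma Environment.rbar_mem [IsProbabilityMeasure μ] (k : Fin K) :
    E.rbar k ∈ Set.Icc (0 : ℝ) 1 := by
  refine ⟨integral_nonneg fun ω => (E.r_mem 0 ω k).1, ?_⟩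
  refine (integral_mono ((bddMeas_r E 0 k).integrable μ) (integrable_const 1)
    fun ω => (E.r_mem 0 ω k).2).trans ?_
  simp

/-- A reward is independent of everything the assignment of its slot depends on. -/
lemma integral_r_mul_pull [IsProbabilityMeasure μ] (t : ℕ) (k : Fin K) :
    ∫ ω, E.r t ω k * pull η R (E.rPath ω) (E.cPath ω) t k ∂μ
      = ∫ ω, E.rbar k * pull η R (E.rPath ω) (E.cPath ω) t k ∂μ := by
  have h1 : Measurable[E.info {Sum.inl t}] fun ω => E.r t ω k :=
    (measurable_pi_apply k).comp (E.measurable_r_info rfl)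
  have h2 : Measurable[E.info (past N t ∪ costIdx N t)]
      fun ω => pull η R (E.rPath ω) (E.cPath ω) t k := by
    refine @Finset.measurable_sum _ _ _ _ _ _ (E.info (past N t ∪ costIdx N t)) _ _ fun n _ => ?_
    exact (measurable_pi_apply k).comp ((measurable_pi_apply n).comp
      (measurable_xhat_past_union E η R t))
  rw [IndepFun.integral_fun_mul_eq_mul_integral
    (E.indepFun_of_disjoint (disjoint_past_union_costIdx_reward t).symm h1 h2)
    (bddMeas_r E t k).measurable.aestronglyMeasurable
    (bddMeas_pull E η R t k).measurable.aestronglyMeasurable, E.integral_r, integral_const_mul]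

end Independence

/-! ### Concentration of the reward estimates -/

section Concentration

variable {Ω : Type*} [MeasurableSpace Ω] {μ : Measure Ω} {N K : ℕ} {cmin : ℝ}
  (E : Environment Ω μ N K cmin) {φ : Fin N → ℝ} (η : ℝ) (R : AssignmentRule K φ)

/-- Hoeffding's exponential supermartingale of arm `k`, whose increments are the centred rewards of
the pulls: `exp (θ (sum of the centred observations) - θ² (number of observations) / 8)`. -/
noncomputable def expProcess (θ : ℝ) (k : Fin K) (t : ℕ) (ω : Ω) : ℝ :=
  Real.exp (θ * ((state η R (E.rPath ω) (E.cPath ω) t).avg k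
      * (state η R (E.rPath ω) (E.cPath ω) t).count k
      - E.rbar k * (state η R (E.rPath ω) (E.cPath ω) t).count k)
    - θ ^ 2 / 8 * (state η R (E.rPath ω) (E.cPath ω) t).count k)

lemma bddMeas_expProcess (θ : ℝ) (k : Fin K) (t : ℕ) : BddMeas (expProcess E η R θ k t) :=
  (((BddMeas.const θ).mul ((bddMeas_avg_mul_count E η R t k).sub
    ((BddMeas.const _).mul (bddMeas_count E η R t k)))).sub
      ((BddMeas.const _).mul (bddMeas_count E η R t k))).exp

lemma integral_exp_reward_le [IsProbabilityMeasure μ] (θ : ℝ) (k : Fin K) (t : ℕ) :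
    ∫ ω, Real.exp (θ * (E.r t ω k - E.rbar k) - θ ^ 2 / 8) ∂μ ≤ 1 := by
  have h := (hasSubgaussianMGF_of_mem_Icc (μ := μ) (X := fun ω => E.r t ω k) (a := 0) (b := 1)
    (bddMeas_r E t k).measurable.aemeasurable (ae_of_all _ fun ω => E.r_mem t ω k)).mgf_le θ
  rw [E.integral_r] at h
  simp only [Real.exp_sub (θ * _)]
  rw [integral_div, div_le_one (Real.exp_pos _)]
  refine h.trans (le_of_eq ?_)
  congr 1
  norm_num
  ring

lemma integral_expProcess_le_one [IsProbabilityMeasure μ] (θ : ℝ) (k : Fin K) (t : ℕ) :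
    ∫ ω, expProcess E η R θ k t ω ∂μ ≤ 1 := by
  induction t with
  | zero => simp [expProcess, state]
  | succ t ih =>
    set Z := expProcess E η R θ k t with hZ
    have hZb : BddMeas Z := bddMeas_expProcess E η R θ k t
    set X : Ω → ℝ := fun ω => pull η R (E.rPath ω) (E.cPath ω) t k with hX
    have hXb : BddMeas X := bddMeas_pull E η R t k
    set W : Ω → ℝ := fun ω => Real.exp (θ * (E.r t ω k - E.rbar k) - θ ^ 2 / 8) with hW
    have hWb : BddMeas W := (((BddMeas.const θ).mul
      ((bddMeas_r E t k).sub (BddMeas.const _))).sub (BddMeas.const _)).exp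
    have hstep : ∀ ω, expProcess E η R θ k (t + 1) ω = Z ω * (1 - X ω) + Z ω * X ω * W ω := by
      intro ω
      simp only [expProcess, avg_mul_count_succ]
      simp only [count_succ, hZ, hX, hW, expProcess]
      rcases pull_eq η R (E.rPath ω) (E.cPath ω) t k with h | h
      · simp [h]
      · simp only [h, sub_self, mul_zero, zero_add, mul_one, ← Real.exp_add, Environment.rPath]
        congr 1
        ring
    simp only [hstep]
    have hZX : BddMeas fun ω => Z ω * X ω := hZb.mul hXb
    have hZX' : BddMeas fun ω => Z ω * (1 - X ω) := hZb.mul ((BddMeas.const 1).sub hXb)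
    rw [integral_add (hZX'.integrable μ) ((hZX.mul hWb).integrable μ)]
    have hind : ∫ ω, Z ω * X ω * W ω ∂μ = (∫ ω, Z ω * X ω ∂μ) * ∫ ω, W ω ∂μ := by
      refine IndepFun.integral_fun_mul_eq_mul_integral (X := fun ω => Z ω * X ω)
        (E.indepFun_of_disjoint (disjoint_past_union_costIdx_reward t) ?_ ?_)
        hZX.measurable.aestronglyMeasurable hWb.measurable.aestronglyMeasurable
      · obtain ⟨-, h2, h3⟩ := measurable_state_past_union E η R t
        have h2' := (measurable_pi_apply k).comp h2
        have h3' := (measurable_pi_apply k).comp h3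
        have hx : Measurable[E.info (past N t ∪ costIdx N t)] X := by
          refine @Finset.measurable_sum _ _ _ _ _ _ (E.info (past N t ∪ costIdx N t)) _ _
            fun n _ => ?_
          exact (measurable_pi_apply k).comp ((measurable_pi_apply n).comp
            (measurable_xhat_past_union E η R t))
        exact ((((h3'.mul h2').sub (h2'.const_mul _)).const_mul θ).sub
          (h2'.const_mul _)).exp.mul hx
      · have h1 : Measurable[E.info {Sum.inl t}] fun ω => E.r t ω k :=
          (measurable_pi_apply k).comp (E.measurable_r_info rfl)
        exact (((h1.sub measurable_const).const_mul θ).sub measurable_const).exp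
    rw [hind]
    have h0 : 0 ≤ ∫ ω, Z ω * X ω ∂μ := integral_nonneg fun ω =>
      mul_nonneg (Real.exp_pos _).le (pull_nonneg η R _ _ t k)
    have h1 : (∫ ω, Z ω * X ω ∂μ) * ∫ ω, W ω ∂μ ≤ ∫ ω, Z ω * X ω ∂μ :=
      mul_le_of_le_one_right h0 (integral_exp_reward_le E θ k t)
    have h2 : ∫ ω, Z ω * (1 - X ω) ∂μ + ∫ ω, Z ω * X ω ∂μ = ∫ ω, Z ω ∂μ := by
      rw [← integral_add (hZX'.integrable μ) (hZX.integrable μ)]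
      exact integral_congr_ae (ae_of_all _ fun ω => by ring)
    linarith

/-- Confidence width in the slot of index `t` of an arm observed `h` times. -/
noncomputable def width (t : ℕ) (h : ℝ) : ℝ := √(3 * Real.log ((t + 1 : ℕ) : ℝ) / (2 * h))

/-- The event that the average reward of arm `k` is off by more than the confidence width, upwards
for `σ = 1` and downwards for `σ = -1`. -/
def offEvent (σ : ℝ) (k : Fin K) (t : ℕ) : Set Ω :=
  {ω | (state η R (E.rPath ω) (E.cPath ω) t).count k ≠ 0 ∧
    width t ((state η R (E.rPath ω) (E.cPath ω) t).count k)
      < σ * ((state η R (E.rPath ω) (E.cPath ω) t).avg k - E.rbar k)}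

lemma measurableSet_offEvent (σ : ℝ) (k : Fin K) (t : ℕ) :
    MeasurableSet (offEvent E η R σ k t) := by
  obtain ⟨-, h2, h3⟩ := measurable_state_env E η R t
  have h2' := measurable_pi_iff.mp h2 k
  have h3' := measurable_pi_iff.mp h3 k
  refine MeasurableSet.inter (h2' (measurableSet_singleton 0).compl) ?_
  exact measurableSet_lt ((measurable_const.div (h2'.const_mul 2)).sqrt)
    ((h3'.sub measurable_const).const_mul σ)

/-- Chernoff's bound for each possible number of observations, and a union bound over them. -/
lemma measureReal_offEvent_le [IsProbabilityMeasure μ] {σ : ℝ} (hσ : σ ^ 2 = 1) (k : Fin K)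
    (t : ℕ) : μ.real (offEvent E η R σ k t) ≤ 1 / ((t : ℝ) + 1) ^ 2 := by
  have hsub : offEvent E η R σ k t ⊆ ⋃ h ∈ Finset.Icc 1 t,
      {ω | ((t : ℝ) + 1) ^ 3 ≤ expProcess E η R (4 * σ * width t (h : ℕ)) k t ω} := by
    rintro ω ⟨h0, h1⟩
    obtain ⟨h, hle, he⟩ := count_eq_natCast η R (E.rPath ω) (E.cPath ω) t k
    rw [he] at h0 h1
    have hpos : 0 < h := Nat.pos_of_ne_zero fun h' => h0 (by simp [h'])
    have hpos' : (0 : ℝ) < h := by exact_mod_cast hpos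
    simp only [Set.mem_iUnion, Finset.mem_Icc]
    refine ⟨h, ⟨hpos, hle⟩, ?_⟩
    change _ ≤ expProcess E η R (4 * σ * width t (h : ℕ)) k t ω
    have hlog : 0 ≤ Real.log ((t + 1 : ℕ) : ℝ) := Real.log_natCast_nonneg _
    have hw0 : 0 ≤ width t h := Real.sqrt_nonneg _
    have hw : width t h ^ 2 * (2 * h) = 3 * Real.log ((t + 1 : ℕ) : ℝ) := by
      rw [width, Real.sq_sqrt (by positivity)]
      field_simp
    have hexp : ((t : ℝ) + 1) ^ 3 = Real.exp (3 * Real.log ((t + 1 : ℕ) : ℝ)) := by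
      rw [mul_comm, Real.exp_mul, Real.exp_log (by positivity)]
      norm_cast
    rw [hexp, expProcess, he, Real.exp_le_exp, ← hw]
    set a := (state η R (E.rPath ω) (E.cPath ω) t).avg k
    set w := width t (h : ℝ)
    have h2 : w * (4 * w * h) ≤ σ * (a - E.rbar k) * (4 * w * h) :=
      mul_le_mul_of_nonneg_right h1.le (by positivity)
    have h3 : (4 * σ * w) ^ 2 / 8 * h = w ^ 2 * (2 * h) := by
      rw [mul_pow, mul_pow, hσ]; ring
    rw [h3]
    nlinarith
  have hpos : (0 : ℝ) < (t : ℝ) + 1 := by positivity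
  have hone : ∀ θ : ℝ, μ.real {ω | ((t : ℝ) + 1) ^ 3 ≤ expProcess E η R θ k t ω}
      ≤ 1 / ((t : ℝ) + 1) ^ 3 := by
    intro θ
    have h1 := mul_meas_ge_le_integral_of_nonneg (μ := μ) (f := expProcess E η R θ k t)
      (ae_of_all _ fun ω => (Real.exp_pos _).le)
      ((bddMeas_expProcess E η R θ k t).integrable μ) (((t : ℝ) + 1) ^ 3)
    rw [le_div_iff₀ (by positivity), mul_comm]
    exact h1.trans (integral_expProcess_le_one E η R θ k t)
  calc μ.real (offEvent E η R σ k t)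
      ≤ μ.real (⋃ h ∈ Finset.Icc 1 t,
          {ω | ((t : ℝ) + 1) ^ 3 ≤ expProcess E η R (4 * σ * width t (h : ℕ)) k t ω}) :=
        measureReal_mono hsub (measure_ne_top _ _)
    _ ≤ ∑ h ∈ Finset.Icc 1 t,
          μ.real {ω | ((t : ℝ) + 1) ^ 3 ≤ expProcess E η R (4 * σ * width t (h : ℕ)) k t ω} :=
        measureReal_biUnion_finset_le _ _
    _ ≤ ∑ _h ∈ Finset.Icc 1 t, 1 / ((t : ℝ) + 1) ^ 3 := Finset.sum_le_sum fun h _ => hone _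
    _ = t / ((t : ℝ) + 1) ^ 3 := by
        rw [Finset.sum_const, Nat.card_Icc, nsmul_eq_mul]; simp; ring
    _ ≤ 1 / ((t : ℝ) + 1) ^ 2 := by
        rw [div_le_div_iff₀ (by positivity) (by positivity)]
        nlinarith [pow_pos hpos 2]

/-- Underestimation of a reward happens only off the confidence interval. -/
lemma integral_rbar_sub_rhat_le [IsProbabilityMeasure μ] (k : Fin K) (t : ℕ) :
    ∫ ω, max (E.rbar k - rhat η R (E.rPath ω) (E.cPath ω) t k) 0 ∂μ
      ≤ 1 / ((t : ℝ) + 1) ^ 2 := by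
  refine le_trans ?_ (measureReal_offEvent_le E η R (σ := -1) (by norm_num) k t)
  rw [← integral_indicator_one (measurableSet_offEvent E η R (-1) k t)]
  refine integral_mono
    (((BddMeas.const _).sub (bddMeas_rhat E η R t k)).max_zero.integrable μ)
    ((integrable_const 1).indicator (measurableSet_offEvent E η R (-1) k t)) fun ω => ?_
  have hb := E.rbar_mem k
  have hr := rhat_nonneg η R (E.rPath ω) (E.cPath ω) (fun s k => (E.r_mem s ω k).1) t k
  by_cases hω : ω ∈ offEvent E η R (-1) k t
  · rw [Set.indicator_of_mem hω]
    exact max_le (by simp only [Pi.one_apply]; linarith [hb.2]) zero_le_one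
  · rw [Set.indicator_of_notMem hω]
    refine max_le (sub_nonpos.mpr ?_) le_rfl
    unfold rhat ucb
    split_ifs with h
    · exact hb.2
    · refine le_min ?_ hb.2
      have h1 : ¬ _ < _ := fun h' => hω ⟨h, h'⟩
      unfold width at h1
      linarith

lemma bddMeas_charge (t : ℕ) (k : Fin K) {a : ℝ} (ha : 0 ≤ a) :
    BddMeas fun ω => (if (state η R (E.rPath ω) (E.cPath ω) t).count k = 0 then 1
      else a / √((state η R (E.rPath ω) (E.cPath ω) t).count k)) := by
  have hm := (bddMeas_count E η R t k).measurable
  refine BddMeas.of_mem_Icc (a := 0) (b := max 1 a)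
    (Measurable.ite (hm (measurableSet_singleton 0)) measurable_const
      (measurable_const.div hm.sqrt)) fun ω => ?_
  obtain ⟨h, -, he⟩ := count_eq_natCast η R (E.rPath ω) (E.cPath ω) t k
  rw [he]
  split_ifs with h0
  · exact ⟨zero_le_one, le_max_left _ _⟩
  · refine ⟨by positivity, le_trans (div_le_self ha (Real.one_le_sqrt.mpr ?_)) (le_max_right _ _)⟩
    have : h ≠ 0 := fun h' => h0 (by simp [h'])
    exact_mod_cast Nat.one_le_iff_ne_zero.mpr this

/-- Overestimation of the reward of a pulled arm is at most twice the confidence width, off an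
event of small probability. -/
lemma integral_rhat_sub_rbar_mul_pull_le [IsProbabilityMeasure μ] (k : Fin K) {t T : ℕ}
    (ht : t < T) :
    ∫ ω, (rhat η R (E.rPath ω) (E.cPath ω) t k - E.rbar k)
        * pull η R (E.rPath ω) (E.cPath ω) t k ∂μ
      ≤ ∫ ω, pull η R (E.rPath ω) (E.cPath ω) t k *
        (if (state η R (E.rPath ω) (E.cPath ω) t).count k = 0 then 1
          else √(6 * Real.log T) / √((state η R (E.rPath ω) (E.cPath ω) t).count k)) ∂μ
        + 1 / ((t : ℝ) + 1) ^ 2 := by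
  have hg := bddMeas_charge E η R t k (Real.sqrt_nonneg (6 * Real.log T))
  have hI := (bddMeas_pull E η R t k).mul hg
  have hind : Integrable ((offEvent E η R 1 k t).indicator (1 : Ω → ℝ)) μ :=
    (integrable_const 1).indicator (measurableSet_offEvent E η R 1 k t)
  refine le_trans ?_ (add_le_add_right
    (measureReal_offEvent_le E η R (σ := 1) (by norm_num) k t) _)
  rw [← integral_indicator_one (measurableSet_offEvent E η R 1 k t),
    ← integral_add (hI.integrable μ) hind]
  refine integral_mono ((((bddMeas_rhat E η R t k).sub (BddMeas.const _)).mul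
    (bddMeas_pull E η R t k)).integrable μ) ((hI.integrable μ).add hind) fun ω => ?_
  change _ ≤ _ + Set.indicator _ _ ω
  have hb := E.rbar_mem k
  have hr := rhat_le_one η R (E.rPath ω) (E.cPath ω) t k
  rcases pull_eq η R (E.rPath ω) (E.cPath ω) t k with hp | hp
  · simp only [hp, mul_zero, zero_mul, zero_add]
    exact Set.indicator_nonneg (fun _ _ => zero_le_one) ω
  simp only [hp, mul_one, one_mul]
  by_cases hω : ω ∈ offEvent E η R 1 k t
  · rw [Set.indicator_of_mem hω]
    simp only [Pi.one_apply]
    have : 0 ≤ (if (state η R (E.rPath ω) (E.cPath ω) t).count k = 0 then 1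
        else √(6 * Real.log T) / √((state η R (E.rPath ω) (E.cPath ω) t).count k)) := by
      split_ifs <;> positivity
    linarith [hb.1]
  · rw [Set.indicator_of_notMem hω, add_zero]
    split_ifs with h
    · linarith [hb.1]
    · have h1 : ¬ _ < _ := fun h' => hω ⟨h, h'⟩
      have hc0 := lt_of_le_of_ne (count_nonneg η R (E.rPath ω) (E.cPath ω) t k) (Ne.symm h)
      have h2 : 2 * width t ((state η R (E.rPath ω) (E.cPath ω) t).count k)
          ≤ √(6 * Real.log T) / √((state η R (E.rPath ω) (E.cPath ω) t).count k) := by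
        rw [← Real.sqrt_div' _ hc0.le, width, show (2 : ℝ) = √4 by
          rw [show (4 : ℝ) = 2 ^ 2 by norm_num, Real.sqrt_sq (by norm_num)], ← Real.sqrt_mul
          (by norm_num)]
        refine Real.sqrt_le_sqrt ?_
        rw [show √(4 : ℝ) = 2 by
          rw [show (4 : ℝ) = 2 ^ 2 by norm_num, Real.sqrt_sq (by norm_num)]]
        have hlog : Real.log ((t + 1 : ℕ) : ℝ) ≤ Real.log T :=
          Real.log_le_log (by positivity) (by exact_mod_cast ht)
        rw [show 4 * (3 * Real.log ((t + 1 : ℕ) : ℝ)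
            / (2 * (state η R (E.rPath ω) (E.cPath ω) t).count k))
            = 6 * Real.log ((t + 1 : ℕ) : ℝ) / (state η R (E.rPath ω) (E.cPath ω) t).count k by
          field_simp; ring]
        exact div_le_div_of_nonneg_right (by linarith) hc0.le
      have h3 : rhat η R (E.rPath ω) (E.cPath ω) t k
          ≤ (state η R (E.rPath ω) (E.cPath ω) t).avg k
            + width t ((state η R (E.rPath ω) (E.cPath ω) t).count k) := by
        unfold rhat ucb width
        rw [if_neg h]
        exact min_le_left _ _
      linarith

lemma sum_one_div_sq_le (T : ℕ) : ∑ t ∈ Finset.range T, 1 / ((t : ℝ) + 1) ^ 2 ≤ 2 := by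
  have key : ∑ t ∈ Finset.range (T + 1), 1 / ((t : ℝ) + 1) ^ 2 ≤ 2 - 1 / ((T : ℝ) + 1) := by
    induction T with
    | zero => norm_num
    | succ T ih =>
      rw [Finset.sum_range_succ]
      have h : 1 / ((T : ℝ) + 1 + 1) ^ 2 ≤ 1 / ((T : ℝ) + 1) - 1 / ((T : ℝ) + 1 + 1) := by
        rw [div_sub_div _ _ (by positivity) (by positivity), div_le_div_iff₀ (by positivity)
          (by positivity)]
        nlinarith [(Nat.cast_nonneg T : (0 : ℝ) ≤ T)]
      push_cast
      linarith
  rw [Finset.sum_range_succ] at key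
  have h1 : (0 : ℝ) ≤ 1 / ((T : ℝ) + 1) := by positivity
  have h2 : (0 : ℝ) ≤ 1 / ((T : ℝ) + 1) ^ 2 := by positivity
  linarith

end Concentration

/-! ### The regret against a given level of welfare -/

section Master

variable {Ω : Type*} [MeasurableSpace Ω] {μ : Measure Ω} {N K : ℕ} {cmin : ℝ}
  (E : Environment Ω μ N K cmin) {φ : Fin N → ℝ} (η : ℝ) (R : AssignmentRule K φ)

/-- The value of the Lagrangian that the mechanism attains in the slot of index `t`. -/
noncomputable def slotLagrangian (t : ℕ) (ω : Ω) : ℝ :=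
  lagrangian φ (xhat η R (E.rPath ω) (E.cPath ω) t) (state η R (E.rPath ω) (E.cPath ω) t).lam
    (rhat η R (E.rPath ω) (E.cPath ω) t) (E.cPath ω t)

/-- Total overestimation, in expectation, of the rewards of the arms pulled during `T` slots. -/
noncomputable def overestimation (T : ℕ) : ℝ :=
  ∑ t ∈ Finset.range T, ∑ k, ∫ ω, (rhat η R (E.rPath ω) (E.cPath ω) t k - E.rbar k)
    * pull η R (E.rPath ω) (E.cPath ω) t k ∂μ

lemma sum_sqrt_le (H : Fin K → ℝ) (hH : ∀ k, 0 ≤ H k) : ∑ k, √(H k) ≤ √(K * ∑ k, H k) := by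
  refine Real.le_sqrt_of_sq_le ?_
  have h := sq_sum_le_card_mul_sum_sq (s := Finset.univ) (f := fun k => √(H k))
  simpa [Real.sq_sqrt, hH] using h

lemma overestimation_le [IsProbabilityMeasure μ] (hη : 0 < η) (hφ : ∀ n, 0 ≤ φ n)
    (hcmin : 0 ≤ cmin) (T : ℕ) :
    overestimation E η R T ≤ 3 * K + 3 * √(6 * Real.log T)
      * √(K * (T * ∑ n, φ n + N * ((1 + η) / η))) := by
  set a := √(6 * Real.log T) with ha
  have ha0 : 0 ≤ a := Real.sqrt_nonneg _
  set B := T * ∑ n, φ n + N * ((1 + η) / η) with hB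
  let g : ℕ → Fin K → Ω → ℝ := fun t k ω => pull η R (E.rPath ω) (E.cPath ω) t k *
    (if (state η R (E.rPath ω) (E.cPath ω) t).count k = 0 then 1
      else a / √((state η R (E.rPath ω) (E.cPath ω) t).count k))
  have hg : ∀ t k, Integrable (g t k) μ := fun t k =>
    ((bddMeas_pull E η R t k).mul (bddMeas_charge E η R t k ha0)).integrable μ
  have h1 : overestimation E η R T
      ≤ ∑ t ∈ Finset.range T, ∑ k, (∫ ω, g t k ω ∂μ + 1 / ((t : ℝ) + 1) ^ 2) :=
    Finset.sum_le_sum fun t ht => Finset.sum_le_sum fun k _ =>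
      integral_rhat_sub_rbar_mul_pull_le E η R k (Finset.mem_range.mp ht)
  have h2 : ∑ t ∈ Finset.range T, ∑ k : Fin K, (∫ ω, g t k ω ∂μ + 1 / ((t : ℝ) + 1) ^ 2)
      = ∫ ω, ∑ k, ∑ t ∈ Finset.range T, g t k ω ∂μ
        + K * ∑ t ∈ Finset.range T, 1 / ((t : ℝ) + 1) ^ 2 := by
    rw [integral_finsetSum _ fun k _ => integrable_finsetSum _ fun t _ => hg t k]
    simp only [Finset.sum_add_distrib]
    congr 1
    · rw [Finset.sum_comm]
      exact Finset.sum_congr rfl fun k _ => (integral_finsetSum _ fun t _ => hg t k).symm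
    · simp [Finset.mul_sum]
  have h3 : ∀ ω, ∑ k, ∑ t ∈ Finset.range T, g t k ω ≤ K + 3 * a * √(K * B) := by
    intro ω
    refine (Finset.sum_le_sum fun k _ =>
      sum_pull_mul_width_le η R (E.rPath ω) (E.cPath ω) ha0 T k).trans ?_
    rw [Finset.sum_add_distrib, ← Finset.mul_sum]
    have h4 := sum_sqrt_le (fun k => (state η R (E.rPath ω) (E.cPath ω) T).count k)
      fun k => count_nonneg η R _ _ T k
    have h5 := sum_count_le η R (E.rPath ω) (E.cPath ω) hη hφ
      (fun s n k => hcmin.trans (E.c_mem s n ω k).1) T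
    have h6 := h4.trans (Real.sqrt_le_sqrt
      (mul_le_mul_of_nonneg_left h5 (Nat.cast_nonneg (α := ℝ) K)))
    have h7 := mul_le_mul_of_nonneg_left h6 (by positivity : 0 ≤ 3 * a)
    simpa using h7
  have h4 : ∫ ω, ∑ k, ∑ t ∈ Finset.range T, g t k ω ∂μ ≤ K + 3 * a * √(K * B) := by
    refine (integral_mono (integrable_finsetSum _ fun k _ => integrable_finsetSum _ fun t _ =>
      hg t k) (integrable_const _) h3).trans ?_
    simp
  have h5 := mul_le_mul_of_nonneg_left (sum_one_div_sq_le T) (Nat.cast_nonneg (α := ℝ) K)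
  rw [h2] at h1
  linarith

lemma bddMeas_welfare (t : ℕ) {f : Fin K → Ω → ℝ} (hf : ∀ k, BddMeas (f k)) :
    BddMeas fun ω => welfare (xhat η R (E.rPath ω) (E.cPath ω) t) 1 (fun k => f k ω)
      (E.cPath ω t) := by
  simp only [welfare_one_eq]
  exact BddMeas.sum _ fun n _ => BddMeas.sum _ fun k _ =>
    ((hf k).sub (bddMeas_c E t n k)).mul (bddMeas_xhat E η R t n k)

lemma welfare_one_sub (x : Fin N → Fin K → ℝ) (r r' : Fin K → ℝ) (c : Fin N → Fin K → ℝ) :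
    welfare x 1 r c - welfare x 1 r' c = ∑ k, (r k - r' k) * ∑ n, x n k := by
  simp only [welfare_one_eq, ← Finset.sum_sub_distrib, Finset.mul_sum]
  rw [Finset.sum_comm]
  exact Finset.sum_congr rfl fun k _ => Finset.sum_congr rfl fun n _ => by ring

/-- The realized welfare is the welfare under the estimated rewards minus the overestimation. -/
lemma expWelfare_eq [IsProbabilityMeasure μ] (t : ℕ) :
    expWelfare E η R t
      = ∫ ω, welfare (xhat η R (E.rPath ω) (E.cPath ω) t) 1 (rhat η R (E.rPath ω) (E.cPath ω) t)
          (E.cPath ω t) ∂μ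
        - ∑ k, ∫ ω, (rhat η R (E.rPath ω) (E.cPath ω) t k - E.rbar k)
            * pull η R (E.rPath ω) (E.cPath ω) t k ∂μ := by
  have hr := bddMeas_r E t
  have hp := bddMeas_pull E η R t
  have hh := bddMeas_rhat E η R t
  have h1 : ∀ k, ∫ ω, (rhat η R (E.rPath ω) (E.cPath ω) t k - E.rbar k)
      * pull η R (E.rPath ω) (E.cPath ω) t k ∂μ
      = ∫ ω, (rhat η R (E.rPath ω) (E.cPath ω) t k - E.r t ω k)
      * pull η R (E.rPath ω) (E.cPath ω) t k ∂μ := by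
    intro k
    simp only [sub_mul]
    rw [integral_sub (((hh k).mul (hp k)).integrable μ)
      (((BddMeas.const _).mul (hp k)).integrable μ),
      integral_sub (((hh k).mul (hp k)).integrable μ) (((hr k).mul (hp k)).integrable μ),
      integral_r_mul_pull]
  simp only [h1]
  unfold expWelfare
  rw [← integral_finsetSum _ fun k _ => (((hh k).sub (hr k)).mul (hp k)).integrable μ,
    ← integral_sub ((bddMeas_welfare E η R t hh).integrable μ)
      ((BddMeas.sum _ fun k _ => ((hh k).sub (hr k)).mul (hp k)).integrable μ)]
  refine integral_congr_ae (ae_of_all _ fun ω => ?_)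
  simp only [ahat_eq_one]
  have := welfare_one_sub (xhat η R (E.rPath ω) (E.cPath ω) t)
    (rhat η R (E.rPath ω) (E.cPath ω) t) (E.rPath ω t) (E.cPath ω t)
  simp only [pull]
  change welfare _ _ (E.rPath ω t) _ = _ - ∑ k, (_ - E.rPath ω t k) * _
  linarith

lemma bddMeas_slotLagrangian (hη : 0 ≤ η) (hφ : ∀ n, 0 ≤ φ n) (hcmin : 0 ≤ cmin) (t : ℕ) :
    BddMeas (slotLagrangian E η R t) := by
  unfold slotLagrangian lagrangian
  exact (bddMeas_welfare E η R t (bddMeas_rhat E η R t)).sub (BddMeas.sum _ fun n _ =>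
    (bddMeas_lam E η R hη hφ hcmin t n).mul ((bddMeas_util E η R t n).sub (BddMeas.const _)))

/-- If in every slot the mechanism attains, up to the underestimation of the rewards, a Lagrangian
value of at least `v`, then its cumulative welfare falls short of `v` per slot by no more than the
drift of the multipliers and the estimation errors. -/
lemma sum_sub_expWelfare_le [IsProbabilityMeasure μ] (hη : 0 < η)
    (hφ : ∀ n, φ n ∈ Set.Icc (0 : ℝ) 1) (hcmin : 0 ≤ cmin) (T : ℕ) {v : ℝ}
    (hv : ∀ t, v - ∑ k, ∫ ω, max (E.rbar k - rhat η R (E.rPath ω) (E.cPath ω) t k) 0 ∂μ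
      ≤ ∫ ω, slotLagrangian E η R t ω ∂μ) :
    T * v - ∑ t ∈ Finset.range T, expWelfare E η R t
      ≤ 2 * K + η * T * (K + ∑ n, φ n) / 2 + overestimation E η R T := by
  have hφ0 : ∀ n, 0 ≤ φ n := fun n => (hφ n).1
  let d : ℕ → Ω → ℝ := fun t ω => ∑ n, (state η R (E.rPath ω) (E.cPath ω) t).lam n
    * (util (xhat η R (E.rPath ω) (E.cPath ω) t) 1 n - φ n)
  have hd : ∀ t, BddMeas (d t) := fun t => BddMeas.sum _ fun n _ =>
    (bddMeas_lam E η R hη.le hφ0 hcmin t n).mul ((bddMeas_util E η R t n).sub (BddMeas.const _))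
  have h1 : ∀ t, v - expWelfare E η R t ≤ K * (1 / ((t : ℝ) + 1) ^ 2) - ∫ ω, d t ω ∂μ
      + ∑ k, ∫ ω, (rhat η R (E.rPath ω) (E.cPath ω) t k - E.rbar k)
        * pull η R (E.rPath ω) (E.cPath ω) t k ∂μ := by
    intro t
    have h2 : ∫ ω, slotLagrangian E η R t ω ∂μ
        = ∫ ω, welfare (xhat η R (E.rPath ω) (E.cPath ω) t) 1
          (rhat η R (E.rPath ω) (E.cPath ω) t) (E.cPath ω t) ∂μ - ∫ ω, d t ω ∂μ := by
      rw [← integral_sub ((bddMeas_welfare E η R t (bddMeas_rhat E η R t)).integrable μ)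
        ((hd t).integrable μ)]
      rfl
    have h3 : ∑ k, ∫ ω, max (E.rbar k - rhat η R (E.rPath ω) (E.cPath ω) t k) 0 ∂μ
        ≤ K * (1 / ((t : ℝ) + 1) ^ 2) := by
      refine (Finset.sum_le_sum fun k _ => integral_rbar_sub_rhat_le E η R k t).trans ?_
      simp
    have h4 := hv t
    rw [expWelfare_eq]
    linarith
  have h2 := Finset.sum_le_sum fun t (_ : t ∈ Finset.range T) => h1 t
  rw [Finset.sum_sub_distrib, Finset.sum_add_distrib, Finset.sum_sub_distrib, ← Finset.mul_sum]
    at h2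
  have h3 : -∑ t ∈ Finset.range T, ∫ ω, d t ω ∂μ ≤ η * T * (K + ∑ n, φ n) / 2 := by
    rw [← integral_finsetSum _ fun t _ => (hd t).integrable μ, ← integral_neg]
    refine (integral_mono ((BddMeas.sum _ fun t _ => hd t).neg.integrable μ) (integrable_const _)
      fun ω => neg_sum_lam_mul_le η R (E.rPath ω) (E.cPath ω) hη hφ T).trans ?_
    simp
  have h4 := mul_le_mul_of_nonneg_left (sum_one_div_sq_le T) (Nat.cast_nonneg (α := ℝ) K)
  simp only [Finset.sum_const, Finset.card_range, nsmul_eq_mul] at h2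
  change _ ≤ _ + overestimation E η R T at h2
  linarith

/-! ### Profit and fairness -/

lemma yhat_mem_Icc (hcmin : 0 ≤ cmin) (t : ℕ) (ω : Ω) (n : Fin N) :
    yhat η R (E.rPath ω) (E.cPath ω) t n ∈ Set.Icc 0
      (∑ k, rhat η R (E.rPath ω) (E.cPath ω) t k * xhat η R (E.rPath ω) (E.cPath ω) t n k) := by
  have hx := xhat_mem η R (E.rPath ω) (E.cPath ω) t
  constructor
  · have h1 := lagrangianWithoutMax_le_sel R n (state η R (E.rPath ω) (E.cPath ω) t).lam
      (rhat η R (E.rPath ω) (E.cPath ω) t) (E.cPath ω t)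
    have h2 := payment_sub_cost (φ := φ) n (xhat η R (E.rPath ω) (E.cPath ω) t)
      (state η R (E.rPath ω) (E.cPath ω) t).lam (rhat η R (E.rPath ω) (E.cPath ω) t)
      (E.cPath ω t) (E.cPath ω t n)
    rw [Function.update_eq_self, xhat_eq] at h2
    have h3 : 0 ≤ ∑ k, E.cPath ω t n k * xhat η R (E.rPath ω) (E.cPath ω) t n k :=
      Finset.sum_nonneg fun k _ => mul_nonneg (hcmin.trans (E.c_mem t n ω k).1)
        (assignments_nonneg hx n k)
    rw [xhat_eq] at h3
    change 0 ≤ payment φ (R.sel _ (rhat η R (E.rPath ω) (E.cPath ω) t) _) _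
      (rhat η R (E.rPath ω) (E.cPath ω) t) _ n
    linarith
  · refine (payment_le n hx _ _ _).trans (Finset.sum_le_sum fun k _ =>
      mul_le_mul_of_nonneg_right ?_ (assignments_nonneg hx n k))
    have := lam_nonneg η R (E.rPath ω) (E.cPath ω) t n
    change rhat η R (E.rPath ω) (E.cPath ω) t k - _ ≤ _
    linarith

lemma bddMeas_yhat (hη : 0 ≤ η) (hφ : ∀ n, 0 ≤ φ n)
    (hcmin : 0 ≤ cmin) (t : ℕ) (n : Fin N) :
    BddMeas fun ω => yhat η R (E.rPath ω) (E.cPath ω) t n := by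
  have hl := fun i => (bddMeas_lam E η R hη hφ hcmin t i).measurable
  have hh := fun k => (bddMeas_rhat E η R t k).measurable
  have hc := fun i k => (bddMeas_c E t i k).measurable
  have hx := fun i k => (bddMeas_xhat E η R t i k).measurable
  have hmeas : ∀ X : Ω → Fin N → Fin K → ℝ, (∀ i k, Measurable fun ω => X ω i k) →
      Measurable fun ω => lagrangianWithout φ n (X ω) (state η R (E.rPath ω) (E.cPath ω) t).lam
        (rhat η R (E.rPath ω) (E.cPath ω) t) (E.cPath ω t) := by
    intro X hX
    simp only [lagrangianWithout_eq]
    exact (Finset.measurable_sum _ fun i _ => Finset.measurable_sum _ fun k _ =>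
      (((hh k).sub (hc i k)).sub (hl i)).mul (hX i k)).add
        (Finset.measurable_sum _ fun i _ => (hl i).mul measurable_const)
  refine BddMeas.of_mem_Icc (a := 0) (b := 1) ?_ fun ω =>
    ⟨(yhat_mem_Icc E η R hcmin t ω n).1,
    (yhat_mem_Icc E η R hcmin t ω n).2.trans ?_⟩
  · refine (Finset.measurable_sum _ fun k _ => ((hh k).sub (hl n)).mul (hx n k)).sub
      (Measurable.sub ?_ (hmeas _ hx))
    exact Measurable.sSup (assignments_finite N K).countable fun x _ =>
      hmeas _ fun i k => measurable_const
  · have hx := xhat_mem η R (E.rPath ω) (E.cPath ω) t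
    refine (Finset.sum_le_sum fun k _ => mul_le_of_le_one_left (assignments_nonneg hx n k)
      (rhat_le_one η R _ _ t k)).trans (hx.2.1 n)

/-- An agent is paid at most the estimated reward of the arm it pulls. -/
lemma neg_overestimation_le_pro [IsProbabilityMeasure μ] (hη : 0 ≤ η) (hφ : ∀ n, 0 ≤ φ n)
    (hcmin : 0 ≤ cmin) (T : ℕ) : -overestimation E η R T ≤ Pro E η R T := by
  unfold overestimation Pro
  rw [← Finset.sum_neg_distrib]
  refine Finset.sum_le_sum fun t _ => ?_
  have hr := bddMeas_r E t
  have hp := bddMeas_pull E η R t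
  have hh := bddMeas_rhat E η R t
  have h1 : -∑ k, ∫ ω, (rhat η R (E.rPath ω) (E.cPath ω) t k - E.rbar k)
      * pull η R (E.rPath ω) (E.cPath ω) t k ∂μ
      = ∫ ω, (∑ k, E.r t ω k * pull η R (E.rPath ω) (E.cPath ω) t k
        - ∑ k, rhat η R (E.rPath ω) (E.cPath ω) t k
          * pull η R (E.rPath ω) (E.cPath ω) t k) ∂μ := by
    rw [integral_sub ((BddMeas.sum _ fun k _ => (hr k).mul (hp k)).integrable μ)
      ((BddMeas.sum _ fun k _ => (hh k).mul (hp k)).integrable μ),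
      integral_finsetSum _ fun k _ => ((hr k).mul (hp k)).integrable μ,
      integral_finsetSum _ fun k _ => ((hh k).mul (hp k)).integrable μ,
      ← Finset.sum_sub_distrib, ← Finset.sum_neg_distrib]
    refine Finset.sum_congr rfl fun k _ => ?_
    simp only [sub_mul]
    rw [integral_sub (((hh k).mul (hp k)).integrable μ)
      (((BddMeas.const _).mul (hp k)).integrable μ), integral_r_mul_pull]
    ring
  rw [h1]
  have hrew : ∀ ω, reward (xhat η R (E.rPath ω) (E.cPath ω) t) 1 (E.rPath ω t)
      = ∑ k, E.r t ω k * pull η R (E.rPath ω) (E.cPath ω) t k := by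
    intro ω
    simp only [reward, pull, Finset.mul_sum, Pi.one_apply, mul_one]
    rfl
  simp only [ahat_eq_one, hrew, Pi.one_apply, one_mul]
  refine integral_mono (((BddMeas.sum _ fun k _ => (hr k).mul (hp k)).sub
    (BddMeas.sum _ fun k _ => (hh k).mul (hp k))).integrable μ)
    (((BddMeas.sum _ fun k _ => (hr k).mul (hp k)).sub
      (BddMeas.sum _ fun n _ => bddMeas_yhat E η R hη hφ hcmin t n)).integrable μ) fun ω => ?_
  refine sub_le_sub_left ?_ _
  refine (Finset.sum_le_sum fun n _ => (yhat_mem_Icc E η R hcmin t ω n).2).trans ?_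
  rw [Finset.sum_comm]
  simp only [pull, Finset.mul_sum, le_refl]

lemma vio_le [IsProbabilityMeasure μ] (hη : 0 < η) (hφ : ∀ n, 0 ≤ φ n) (hcmin : 0 ≤ cmin)
    (T : ℕ) : Vio E η R T ≤ N * ((1 + η) / η) := by
  unfold Vio
  have h : ∀ n : Fin N, ∫ ω, max (∑ t ∈ Finset.range T,
      (util (xhat η R (E.rPath ω) (E.cPath ω) t) (ahat η R (E.rPath ω) (E.cPath ω) t) n - φ n)) 0
      ∂μ ≤ (1 + η) / η := by
    intro n
    simp only [ahat_eq_one]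
    refine (integral_mono ((BddMeas.sum _ fun t _ =>
      (bddMeas_util E η R t n).sub (BddMeas.const (φ n))).max_zero.integrable μ)
      (integrable_const ((1 + η) / η)) fun ω => max_le ?_ (by positivity)).trans (by simp)
    exact sum_util_sub_le η R _ _ hη hφ (fun s n k => hcmin.trans (E.c_mem s n ω k).1) T n
  refine (Finset.sum_le_sum fun n _ => h n).trans ?_
  simp

end Master

/-! ### Comparison with policies that know the costs -/

section Benchmark

variable {Ω : Type*} [MeasurableSpace Ω] {μ : Measure Ω} {N K : ℕ} {cmin : ℝ}
  (E : Environment Ω μ N K cmin) {φ : Fin N → ℝ} (η : ℝ) (R : AssignmentRule K φ)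

/-- The cost matrix of a slot keeps its law when the agents are permuted and the slot changes. -/
lemma Environment.identDistrib_costs [IsProbabilityMeasure μ] (t t' : ℕ) {σ σ' : Fin N → Fin N}
    (hσ : σ.Injective) (hσ' : σ'.Injective) :
    IdentDistrib (fun ω n => E.c t (σ n) ω) (fun ω n => E.c t' (σ' n) ω) μ μ := by
  have hm : ∀ (t : ℕ) (σ : Fin N → Fin N), Measurable fun ω n => E.c t (σ n) ω := fun t σ =>
    measurable_pi_lambda _ fun n => E.measurable_c t (σ n)
  have hpi : ∀ (t : ℕ) (σ : Fin N → Fin N), σ.Injective → μ.map (fun ω n => E.c t (σ n) ω)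
      = Measure.pi fun n => μ.map (E.c t (σ n)) := by
    intro t σ hσ
    refine (iIndepFun_iff_map_fun_eq_pi_map fun n => (E.measurable_c t (σ n)).aemeasurable).mp ?_
    exact E.indep.precomp (g := fun n => Sum.inr (t, σ n)) fun a b h => hσ (by simpa using h)
  refine ⟨(hm t σ).aemeasurable, (hm t' σ').aemeasurable, ?_⟩
  rw [hpi t σ hσ, hpi t' σ' hσ']
  congr 1
  funext n
  exact (E.c_ident t (σ n) t' (σ' n)).map_eq

lemma Environment.integral_costLaw [IsProbabilityMeasure μ] (t : ℕ)
    {F : (Fin N → Fin K → ℝ) → ℝ} (hF : Measurable F) :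
    ∫ c, F c ∂E.costLaw = ∫ ω, F (E.cPath ω t) ∂μ := by
  rw [Environment.costLaw, integral_map (E.measurable_cPath 0).aemeasurable
    hF.aestronglyMeasurable]
  exact ((E.identDistrib_costs 0 t Function.injective_id Function.injective_id).comp
    hF).integral_eq

/-- The multipliers are independent of the costs of the slot. -/
lemma integral_lam_mul [IsProbabilityMeasure μ] (hη : 0 ≤ η) (hφ : ∀ n, 0 ≤ φ n)
    (hcmin : 0 ≤ cmin) (t : ℕ) (n : Fin N) {F : (Fin N → Fin K → ℝ) → ℝ} (hF : Measurable F) :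
    ∫ ω, (state η R (E.rPath ω) (E.cPath ω) t).lam n * F (E.cPath ω t) ∂μ
      = (∫ ω, (state η R (E.rPath ω) (E.cPath ω) t).lam n ∂μ) * ∫ ω, F (E.cPath ω t) ∂μ := by
  have h1 : Measurable[E.info (past N t)]
      fun ω => (state η R (E.rPath ω) (E.cPath ω) t).lam n :=
    (measurable_pi_apply n).comp (measurable_state_past E η R t).1
  have h2 : Measurable[E.info (costIdx N t)] fun ω => F (E.cPath ω t) :=
    hF.comp (E.measurable_cPath_info fun _ => rfl)
  exact IndepFun.integral_fun_mul_eq_mul_integral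
    (E.indepFun_of_disjoint (disjoint_past_costIdx t) h1 h2)
    (bddMeas_lam E η R hη hφ hcmin t n).measurable.aestronglyMeasurable
    (hF.comp (E.measurable_cPath t)).aestronglyMeasurable

lemma sum_rbar_mul_le (ρ ρ' : Fin K → ℝ) {q : Fin K → ℝ} (hq : ∀ k, q k ∈ Set.Icc (0 : ℝ) 1) :
    ∑ k, ρ k * q k - ∑ k, max (ρ k - ρ' k) 0 ≤ ∑ k, ρ' k * q k := by
  rw [← Finset.sum_sub_distrib]
  refine Finset.sum_le_sum fun k _ => ?_
  have h1 : ρ k - ρ' k ≤ max (ρ k - ρ' k) 0 := le_max_left _ _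
  have h2 : 0 ≤ max (ρ k - ρ' k) 0 := le_max_right _ _
  nlinarith [(hq k).1, (hq k).2]

/-- In expectation the multipliers do not penalize a policy that obeys the caps on average. -/
lemma policy_le_slotLagrangian [IsProbabilityMeasure μ] (hη : 0 ≤ η) (hφ : ∀ n, 0 ≤ φ n)
    (hcmin : 0 ≤ cmin) (t : ℕ) {x : (Fin N → Fin K → ℝ) → (Fin N → Fin K → ℝ)}
    (hx : Measurable x) (hxmem : ∀ c, x c ∈ assignments N K)
    (hcap : ∀ n, ∫ c, util (x c) 1 n ∂E.costLaw ≤ φ n) :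
    ∫ c, ∑ k, ∑ n, (E.rbar k - c n k) * x c n k ∂E.costLaw
        - ∑ k, ∫ ω, max (E.rbar k - rhat η R (E.rPath ω) (E.cPath ω) t k) 0 ∂μ
      ≤ ∫ ω, slotLagrangian E η R t ω ∂μ := by
  have hx' : ∀ n k, Measurable fun c => x c n k := fun n k =>
    (measurable_pi_apply k).comp ((measurable_pi_apply n).comp hx)
  have hutil : ∀ n, Measurable fun c => util (x c) 1 n := fun n => by
    simp only [util_one]; exact Finset.measurable_sum _ fun k _ => hx' n k
  have hl := bddMeas_lam E η R hη hφ hcmin t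
  have hd : ∀ k, BddMeas fun ω => max (E.rbar k - rhat η R (E.rPath ω) (E.cPath ω) t k) 0 :=
    fun k => ((BddMeas.const _).sub (bddMeas_rhat E η R t k)).max_zero
  have hxb : ∀ n k, BddMeas fun ω => x (E.cPath ω t) n k := fun n k =>
    BddMeas.of_mem_Icc (a := 0) (b := 1) ((hx' n k).comp (E.measurable_cPath t)) fun ω =>
      ⟨assignments_nonneg (hxmem _) n k, assignments_le_one (hxmem _) n k⟩
  have hub : ∀ n, BddMeas fun ω => util (x (E.cPath ω t)) 1 n := fun n => by
    simp only [util_one]; exact BddMeas.sum _ fun k _ => hxb n k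
  have hw : BddMeas fun ω => ∑ k, ∑ n, (E.rbar k - E.cPath ω t n k) * x (E.cPath ω t) n k :=
    BddMeas.sum _ fun k _ => BddMeas.sum _ fun n _ =>
      ((BddMeas.const _).sub (bddMeas_c E t n k)).mul (hxb n k)
  have hpen : BddMeas fun ω => ∑ n, ((state η R (E.rPath ω) (E.cPath ω) t).lam n
      * util (x (E.cPath ω t)) 1 n - (state η R (E.rPath ω) (E.cPath ω) t).lam n * φ n) :=
    BddMeas.sum _ fun n _ => ((hl n).mul (hub n)).sub ((hl n).mul (BddMeas.const _))
  have hpt : ∀ ω, ∑ k, ∑ n, (E.rbar k - E.cPath ω t n k) * x (E.cPath ω t) n k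
      - ∑ k, max (E.rbar k - rhat η R (E.rPath ω) (E.cPath ω) t k) 0
      - ∑ n, ((state η R (E.rPath ω) (E.cPath ω) t).lam n * util (x (E.cPath ω t)) 1 n
        - (state η R (E.rPath ω) (E.cPath ω) t).lam n * φ n) ≤ slotLagrangian E η R t ω := by
    intro ω
    refine le_trans ?_ (lagrangian_le_xhat η R (E.rPath ω) (E.cPath ω) t (hxmem (E.cPath ω t)))
    unfold lagrangian
    simp only [mul_sub]
    refine sub_le_sub_right ?_ _
    have h1 := sum_rbar_mul_le E.rbar (rhat η R (E.rPath ω) (E.cPath ω) t)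
      (q := fun k => ∑ n, x (E.cPath ω t) n k) fun k =>
        ⟨Finset.sum_nonneg fun n _ => assignments_nonneg (hxmem _) n k, (hxmem _).2.2 k⟩
    have h2 := welfare_one_sub (x (E.cPath ω t)) (rhat η R (E.rPath ω) (E.cPath ω) t) E.rbar
      (E.cPath ω t)
    simp only [sub_mul, Finset.sum_sub_distrib] at h2
    have h3 := welfare_one_eq (x (E.cPath ω t)) E.rbar (E.cPath ω t)
    rw [Finset.sum_comm] at h3
    linarith
  have h1 := integral_mono (((hw.sub (BddMeas.sum _ fun k _ => hd k)).sub hpen).integrable μ)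
    ((bddMeas_slotLagrangian E η R hη hφ hcmin t).integrable μ) hpt
  rw [integral_sub ((hw.sub (BddMeas.sum _ fun k _ => hd k)).integrable μ) (hpen.integrable μ),
    integral_sub (hw.integrable μ) ((BddMeas.sum _ fun k _ => hd k).integrable μ),
    integral_finsetSum _ fun k _ => (hd k).integrable μ] at h1
  have h2 : ∫ ω, ∑ n, ((state η R (E.rPath ω) (E.cPath ω) t).lam n
      * util (x (E.cPath ω t)) 1 n - (state η R (E.rPath ω) (E.cPath ω) t).lam n * φ n) ∂μ
      ≤ 0 := by
    rw [integral_finsetSum _ fun n _ =>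
      (((hl n).mul (hub n)).sub ((hl n).mul (BddMeas.const _))).integrable μ]
    refine Finset.sum_nonpos fun n _ => ?_
    rw [integral_sub (((hl n).mul (hub n)).integrable μ)
      (((hl n).mul (BddMeas.const _)).integrable μ), integral_mul_const,
      integral_lam_mul E η R hη hφ hcmin t n (hutil n), ← E.integral_costLaw t (hutil n), ← mul_sub]
    exact mul_nonpos_of_nonneg_of_nonpos (integral_nonneg fun ω => lam_nonneg η R _ _ t n)
      (sub_nonpos.mpr (hcap n))
  have hcoord : ∀ n k, Measurable fun c : Fin N → Fin K → ℝ => c n k := fun n k =>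
    (measurable_pi_apply k).comp (measurable_pi_apply n)
  have hval : Measurable fun c => ∑ k, ∑ n, (E.rbar k - c n k) * x c n k :=
    Finset.measurable_sum _ fun k _ => Finset.measurable_sum _ fun n _ =>
      (measurable_const.sub (hcoord n k)).mul (hx' n k)
  rw [E.integral_costLaw t hval]
  linarith

end Benchmark

/-! ### Comparison with selection probabilities at minimal cost -/

section UpperBound

lemma exists_measurable_argmin (M : ℕ) [NeZero M] :
    ∃ a : (Fin M → ℝ) → Fin M, Measurable a ∧ ∀ (y : Fin M → ℝ) (m : Fin M), y (a y) ≤ y m := by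
  classical
  have hex : ∀ y : Fin M → ℝ, ∃ i : ℕ, ∃ h : i < M, ∀ m, y ⟨i, h⟩ ≤ y m := fun y => by
    obtain ⟨i, hi⟩ := Finite.exists_min y
    exact ⟨i, i.2, hi⟩
  have hmeas : ∀ i : ℕ, MeasurableSet {y : Fin M → ℝ | ∃ h : i < M, ∀ m, y ⟨i, h⟩ ≤ y m} := by
    intro i
    by_cases h : i < M
    · simp only [h, exists_true_left]
      rw [Set.ofPred_forall]
      exact MeasurableSet.iInter fun m =>
        measurableSet_le (measurable_pi_apply _) (measurable_pi_apply m)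
    · simp [h]
  refine ⟨fun y => ⟨Nat.find (hex y), (Nat.find_spec (hex y)).1⟩, ?_,
    fun y m => (Nat.find_spec (hex y)).2 m⟩
  refine measurable_to_countable' fun m => ?_
  have : (fun y => (⟨Nat.find (hex y), (Nat.find_spec (hex y)).1⟩ : Fin M)) ⁻¹' {m}
      = (fun y => Nat.find (hex y)) ⁻¹' {(m : ℕ)} := by
    ext y; simp [Fin.ext_iff]
  rw [this]
  exact measurable_find hex hmeas (measurableSet_singleton _)

variable {N K : ℕ} {φ : Fin N → ℝ}

/-- Pull arm `k` by agent `g k` whenever this pays: the maximum of the Lagrangian is at least what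
any pulling probabilities attain. -/
lemma sum_mul_le_lagrangian_sel (R : AssignmentRule K φ) (lam : Fin N → ℝ) (rh : Fin K → ℝ)
    (c : Fin N → Fin K → ℝ) {g : Fin K → Fin N} (hg : g.Injective) {p : Fin K → ℝ}
    (hp : ∀ k, p k ∈ Set.Icc (0 : ℝ) 1) :
    ∑ k, p k * (rh k - c (g k) k - lam (g k)) + ∑ n, lam n * φ n
      ≤ lagrangian φ (R.sel lam rh c) lam rh c := by
  classical
  let w : Fin K → ℝ := fun k => rh k - c (g k) k - lam (g k)
  let x : Fin N → Fin K → ℝ := fun n k => if n = g k ∧ 0 ≤ w k then 1 else 0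
  have hx : x ∈ assignments N K := by
    refine ⟨fun n k => ?_, fun n => ?_, fun k => ?_⟩
    · by_cases h : n = g k ∧ 0 ≤ w k
      · exact Or.inr (if_pos h)
      · exact Or.inl (if_neg h)
    · by_cases h : ∃ k, n = g k
      · obtain ⟨k, rfl⟩ := h
        rw [Finset.sum_eq_single k]
        · simp only [x]; split_ifs <;> norm_num
        · intro k' _ hk'
          exact if_neg fun h' => hk' (hg h'.1).symm
        · simp
      · rw [Finset.sum_eq_zero]
        · exact zero_le_one
        · intro k _
          exact if_neg fun h' => h ⟨k, h'.1⟩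
    · rw [Finset.sum_eq_single (g k)]
      · simp only [x]; split_ifs <;> norm_num
      · intro n _ hn
        exact if_neg fun h' => hn h'.1
      · simp
  refine le_trans ?_ (R.sel_max lam rh c x hx)
  rw [lagrangian_eq, Finset.sum_comm]
  refine add_le_add_left (Finset.sum_le_sum fun k _ => ?_) _
  rw [Finset.sum_eq_single (g k)]
  · change p k * w k ≤ w k * x (g k) k
    simp only [x, true_and]
    split_ifs with h
    · rw [mul_one]; exact mul_le_of_le_one_left h (hp k).2
    · rw [mul_zero]
      exact mul_nonpos_of_nonneg_of_nonpos (hp k).1 (not_le.mp h).le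
  · intro n _ hn
    simp only [x, hn, false_and, if_false, mul_zero]
  · simp

variable {Ω : Type*} [MeasurableSpace Ω] {μ : Measure Ω} {cmin : ℝ}
  (E : Environment Ω μ N K cmin) (η : ℝ) (R : AssignmentRule K φ)

/-- The least cost of arm `k` among `M` agents exceeds the minimal cost by at most `1 / (κ M)`, in
expectation. -/
lemma integral_min_cost_le [IsProbabilityMeasure μ] {κ : ℝ} (hκ : 0 < κ) (hE : E.LinearMass κ)
    (t : ℕ) (k : Fin K) {M : ℕ} [NeZero M] {e : Fin M → Fin N} (he : e.Injective)
    {a : Ω → Fin M} (ha : Measurable fun ω => E.c t (e (a ω)) ω k)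
    (hmin : ∀ ω m, E.c t (e (a ω)) ω k ≤ E.c t (e m) ω k) :
    ∫ ω, E.c t (e (a ω)) ω k ∂μ ≤ cmin + 1 / (κ * M) := by
  have hM : (0 : ℝ) < M := by exact_mod_cast Nat.pos_of_ne_zero (NeZero.ne M)
  let Y : Ω → ℝ := fun ω => E.c t (e (a ω)) ω k - cmin
  have hYb : BddMeas Y := BddMeas.of_mem_Icc (a := 0) (b := 1 - cmin) (ha.sub measurable_const)
    fun ω => ⟨sub_nonneg.mpr (E.c_mem _ _ _ _).1, sub_le_sub_right (E.c_mem _ _ _ _).2 _⟩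
  have htail : ∀ s ∈ Set.Ioi (0 : ℝ), μ.real {ω | s < Y ω} ≤ Real.exp (-(κ * M) * s) := by
    intro s hs
    rw [Set.mem_Ioi] at hs
    rcases le_or_gt s (1 - cmin) with hs1 | hs1
    · have hsub : {ω | s < Y ω} ⊆ ⋂ m ∈ (Finset.univ : Finset (Fin M)),
          (E.c t (e m)) ⁻¹' {y | cmin + s < y k} := by
        intro ω hω
        have hω' : s < Y ω := hω
        simp only [Set.mem_iInter]
        intro m _
        change cmin + s < E.c t (e m) ω k
        have := hmin ω m
        simp only [Y] at hω'
        linarith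
      have hind : iIndepFun (fun m => E.c t (e m)) μ :=
        E.indep.precomp (g := fun m => Sum.inr (t, e m)) fun a b h => he (by simpa using h)
      have hS : MeasurableSet {y : Fin K → ℝ | cmin + s < y k} :=
        measurableSet_lt measurable_const (measurable_pi_apply k)
      have h1 := hind.measure_inter_preimage_eq_mul Finset.univ
        (sets := fun _ => {y : Fin K → ℝ | cmin + s < y k}) fun m _ => hS
      have h2 : ∀ m, μ.real ((E.c t (e m)) ⁻¹' {y | cmin + s < y k}) ≤ Real.exp (-(κ * s)) := by
        intro m
        have h3 := hE t (e m) k s ⟨hs.le, hs1⟩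
        have h4 : (E.c t (e m)) ⁻¹' {y | cmin + s < y k}
            = {ω | E.c t (e m) ω k ≤ cmin + s}ᶜ := by
          ext ω; simp
        rw [h4, probReal_compl_eq_one_sub (measurableSet_le
          (bddMeas_c E t (e m) k).measurable measurable_const)]
        linarith [Real.add_one_le_exp (-(κ * s))]
      calc μ.real {ω | s < Y ω}
          ≤ μ.real (⋂ m ∈ (Finset.univ : Finset (Fin M)),
              (E.c t (e m)) ⁻¹' {y | cmin + s < y k}) :=
            measureReal_mono hsub (measure_ne_top _ _)
        _ = ∏ m : Fin M, μ.real ((E.c t (e m)) ⁻¹' {y | cmin + s < y k}) := by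
            simp only [Measure.real, h1, ENNReal.toReal_prod]
        _ ≤ ∏ _m : Fin M, Real.exp (-(κ * s)) :=
            Finset.prod_le_prod (fun m _ => measureReal_nonneg) fun m _ => h2 m
        _ = Real.exp (-(κ * M) * s) := by
            rw [Finset.prod_const, Finset.card_univ, Fintype.card_fin, ← Real.exp_nat_mul]
            congr 1; ring
    · have : {ω | s < Y ω} = ∅ := by
        ext ω
        simp only [Set.mem_ofPred_eq, Set.mem_empty_iff_false, iff_false, not_lt, Y]
        linarith [(E.c_mem t (e (a ω)) ω k).2]
      rw [this]; simp [Real.exp_nonneg]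
  have hint : IntegrableOn (fun s : ℝ => Real.exp (-(κ * M) * s)) (Set.Ioi 0) :=
    integrableOn_exp_mul_Ioi (by nlinarith) 0
  have h1 : ∫ ω, Y ω ∂μ ≤ 1 / (κ * M) := by
    rw [(hYb.integrable μ).integral_eq_integral_meas_lt
      (ae_of_all _ fun ω => sub_nonneg.mpr (E.c_mem _ _ _ _).1)]
    calc ∫ s in Set.Ioi (0 : ℝ), μ.real {ω | s < Y ω}
        ≤ ∫ s in Set.Ioi (0 : ℝ), Real.exp (-(κ * M) * s) :=
          integral_mono_of_nonneg (ae_of_all _ fun s => measureReal_nonneg) hint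
            ((ae_restrict_iff' measurableSet_Ioi).mpr (ae_of_all _ htail))
      _ = 1 / (κ * M) := by
          rw [integral_exp_mul_Ioi (by nlinarith)]
          simp
  have h2 : ∫ ω, E.c t (e (a ω)) ω k ∂μ = ∫ ω, Y ω ∂μ + cmin := by
    rw [← sub_eq_iff_eq_add]
    simp only [Y]
    have hc : BddMeas fun ω => E.c t (e (a ω)) ω k :=
      BddMeas.of_mem_Icc ha fun ω => E.c_mem _ _ _ _
    rw [integral_sub (hc.integrable μ) (integrable_const _)]
    simp
  linarith

/-- Split the agents into groups of `M`, one group for each arm, and let arm `k` be pulled with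
probability `p k` by the cheapest agent of its group. Rotating the groups over the agents uses
every agent equally often, hence within the caps `α / N`, since the cost vectors of the agents are
exchangeable. As the multipliers are independent of the costs of the slot, it suffices to average
the values of the Lagrangian over the rotations, and no randomization is needed. -/
lemma probabilities_le_slotLagrangian [IsProbabilityMeasure μ] {α : ℝ}
    (R : AssignmentRule K (crowdCap α N)) (hη : 0 ≤ η) (hα : 0 ≤ α) (hcmin : 0 ≤ cmin)
    {κ : ℝ} (hκ : 0 < κ) (hE : E.LinearMass κ) {M : ℕ} (hM : 0 < M) (hMN : K * M ≤ N)
    {p : Fin K → ℝ} (hp : ∀ k, p k ∈ Set.Icc (0 : ℝ) 1) (hpα : ∑ k, p k ≤ α) (hN : 0 < N) (t : ℕ) :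
    ∑ k, (E.rbar k - cmin) * p k - α * (1 / (κ * M))
        - ∑ k, ∫ ω, max (E.rbar k - rhat η R (E.rPath ω) (E.cPath ω) t k) 0 ∂μ
      ≤ ∫ ω, slotLagrangian E η R t ω ∂μ := by
  classical
  have : NeZero N := ⟨hN.ne'⟩
  have : NeZero M := ⟨hM.ne'⟩
  have hφ : ∀ n, 0 ≤ crowdCap α N n := fun n => by unfold crowdCap; positivity
  obtain ⟨a, ham, hamin⟩ := exists_measurable_argmin M
  let e : Fin K → Fin M → Fin N := fun k m => Fin.castLE hMN (finProdFinEquiv (k, m))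
  have he : ∀ k m k' m', e k m = e k' m' → k = k' ∧ m = m' := by
    intro k m k' m' h
    have := finProdFinEquiv.injective (Fin.castLE_injective hMN h)
    simpa using this
  -- the agent that pulls arm `k` before rotation
  let s : Fin K → (Fin N → Fin K → ℝ) → Fin N := fun k c => e k (a fun m => c (e k m) k)
  have hs : ∀ k, Measurable (s k) := fun k =>
    (measurable_of_countable (e k)).comp (ham.comp (measurable_pi_lambda _ fun m =>
      (measurable_pi_apply k).comp (measurable_pi_apply (e k m))))
  -- costs as seen after rotating the agents by `j`
  let rot : Fin N → (Fin N → Fin K → ℝ) → (Fin N → Fin K → ℝ) := fun j c n => c (j + n)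
  have hrot : ∀ j, Measurable (rot j) := fun j =>
    measurable_pi_lambda _ fun n => measurable_pi_apply (j + n)
  have hlaw : ∀ j (F : (Fin N → Fin K → ℝ) → ℝ), Measurable F →
      ∫ ω, F (rot j (E.cPath ω t)) ∂μ = ∫ ω, F (E.cPath ω t) ∂μ := fun j F hF =>
    ((E.identDistrib_costs t t (add_right_injective j) Function.injective_id).comp hF).integral_eq
  let L : Fin N → ℝ := fun n => ∫ ω, (state η R (E.rPath ω) (E.cPath ω) t).lam n ∂μ
  have hL : ∀ n, 0 ≤ L n := fun n => integral_nonneg fun ω => lam_nonneg η R _ _ t n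
  have hl := bddMeas_lam E η R hη hφ hcmin t
  let Q : Fin K → Fin N → ℝ := fun k m => ∫ ω, (if s k (E.cPath ω t) = m then 1 else 0) ∂μ
  have hind : ∀ k m, Measurable fun c => (if s k c = m then (1 : ℝ) else 0) := fun k m =>
    Measurable.ite (hs k (measurableSet_singleton m)) measurable_const measurable_const
  have hQ : ∀ k, ∑ m, Q k m = 1 := by
    intro k
    simp only [Q]
    rw [← integral_finsetSum]
    · simp
    · intro m _
      exact (BddMeas.of_mem_Icc (a := 0) (b := 1) ((hind k m).comp (E.measurable_cPath t))
        fun ω => by simp only [Function.comp_apply]; split_ifs <;> simp).integrable μ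
  have hcs : ∀ k, Measurable fun c : Fin N → Fin K → ℝ => c (s k c) k := fun k => by
    have : (fun c : Fin N → Fin K → ℝ => c (s k c) k)
        = fun c => ∑ m, (if s k c = m then (1 : ℝ) else 0) * c m k := by
      funext c; simp
    rw [this]
    exact Finset.measurable_sum _ fun m _ =>
      (hind k m).mul ((measurable_pi_apply k).comp (measurable_pi_apply m))
  have hC : ∀ k, ∫ ω, E.cPath ω t (s k (E.cPath ω t)) k ∂μ ≤ cmin + 1 / (κ * M) := fun k =>
    integral_min_cost_le E hκ hE t k (e := e k) (fun m m' h => (he k m k m' h).2)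
      (a := fun ω => a fun m => E.cPath ω t (e k m) k) ((hcs k).comp (E.measurable_cPath t))
      fun ω m => hamin (fun m => E.cPath ω t (e k m) k) m
  have hd : ∀ k, BddMeas fun ω => max (E.rbar k - rhat η R (E.rPath ω) (E.cPath ω) t k) 0 :=
    fun k => ((BddMeas.const _).sub (bddMeas_rhat E η R t k)).max_zero
  -- the value of the Lagrangian under the rotation by `j`
  have hj : ∀ j, ∑ k, E.rbar k * p k
      - ∑ k, ∫ ω, max (E.rbar k - rhat η R (E.rPath ω) (E.cPath ω) t k) 0 ∂μ
      - ∑ k, p k * (cmin + 1 / (κ * M)) - ∑ k, p k * ∑ m, L (j + m) * Q k m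
      + ∑ n, L n * (α / N) ≤ ∫ ω, slotLagrangian E η R t ω ∂μ := by
    intro j
    have hc' : ∀ k, BddMeas fun ω => rot j (E.cPath ω t) (s k (rot j (E.cPath ω t))) k := fun k =>
      BddMeas.of_mem_Icc (((hcs k).comp (hrot j)).comp (E.measurable_cPath t)) fun ω =>
        E.c_mem _ _ _ _
    have hi' : ∀ k m, BddMeas fun ω => (if s k (rot j (E.cPath ω t)) = m then (1 : ℝ) else 0) :=
      fun k m => BddMeas.of_mem_Icc (a := 0) (b := 1)
        (((hind k m).comp (hrot j)).comp (E.measurable_cPath t))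
        fun ω => by split_ifs <;> simp
    have hpt : ∀ ω, ∑ k, E.rbar k * p k
        - ∑ k, max (E.rbar k - rhat η R (E.rPath ω) (E.cPath ω) t k) 0
        - ∑ k, p k * rot j (E.cPath ω t) (s k (rot j (E.cPath ω t))) k
        - ∑ k, p k * ∑ m, (state η R (E.rPath ω) (E.cPath ω) t).lam (j + m)
            * (if s k (rot j (E.cPath ω t)) = m then (1 : ℝ) else 0)
        + ∑ n, (state η R (E.rPath ω) (E.cPath ω) t).lam n * (α / N)
        ≤ slotLagrangian E η R t ω := by
      intro ω
      have h1 := sum_mul_le_lagrangian_sel R (state η R (E.rPath ω) (E.cPath ω) t).lam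
        (rhat η R (E.rPath ω) (E.cPath ω) t) (E.cPath ω t)
        (g := fun k => j + s k (rot j (E.cPath ω t)))
        (fun k k' h => (he _ _ _ _ (add_left_cancel h)).1) hp
      refine le_trans ?_ h1
      refine add_le_add_left ?_ _
      have h2 := sum_rbar_mul_le E.rbar (rhat η R (E.rPath ω) (E.cPath ω) t) hp
      have h3 : ∑ k, p k * (rhat η R (E.rPath ω) (E.cPath ω) t k
            - E.cPath ω t (j + s k (rot j (E.cPath ω t))) k
            - (state η R (E.rPath ω) (E.cPath ω) t).lam (j + s k (rot j (E.cPath ω t))))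
          = ∑ k, rhat η R (E.rPath ω) (E.cPath ω) t k * p k
            - ∑ k, p k * rot j (E.cPath ω t) (s k (rot j (E.cPath ω t))) k
            - ∑ k, p k * ∑ m, (state η R (E.rPath ω) (E.cPath ω) t).lam (j + m)
              * (if s k (rot j (E.cPath ω t)) = m then (1 : ℝ) else 0) := by
        rw [← Finset.sum_sub_distrib, ← Finset.sum_sub_distrib]
        refine Finset.sum_congr rfl fun k _ => ?_
        simp only [mul_ite, mul_one, mul_zero, Finset.sum_ite_eq, Finset.mem_univ, if_true, rot]
        ring
      rw [h3]
      linarith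
    have hb1 : BddMeas fun ω => ∑ k, E.rbar k * p k
        - ∑ k, max (E.rbar k - rhat η R (E.rPath ω) (E.cPath ω) t k) 0 :=
      (BddMeas.const _).sub (BddMeas.sum _ fun k _ => hd k)
    have hb2 : BddMeas fun ω => ∑ k, p k * rot j (E.cPath ω t) (s k (rot j (E.cPath ω t))) k :=
      BddMeas.sum _ fun k _ => (BddMeas.const _).mul (hc' k)
    have hb3 : ∀ k, BddMeas fun ω => ∑ m, (state η R (E.rPath ω) (E.cPath ω) t).lam (j + m)
            * (if s k (rot j (E.cPath ω t)) = m then (1 : ℝ) else 0) := fun k =>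
      BddMeas.sum _ fun m _ => (hl _).mul (hi' k m)
    have hb3' : BddMeas fun ω => ∑ k, p k * ∑ m,
        (state η R (E.rPath ω) (E.cPath ω) t).lam (j + m)
            * (if s k (rot j (E.cPath ω t)) = m then (1 : ℝ) else 0) :=
      BddMeas.sum _ fun k _ => (BddMeas.const _).mul (hb3 k)
    have hb4 : BddMeas fun ω => ∑ n, (state η R (E.rPath ω) (E.cPath ω) t).lam n * (α / N) :=
      BddMeas.sum _ fun n _ => (hl n).mul (BddMeas.const _)
    have h1 := integral_mono ((((hb1.sub hb2).sub hb3').add hb4).integrable μ)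
      ((bddMeas_slotLagrangian E η R hη hφ hcmin t).integrable μ) hpt
    rw [integral_add (((hb1.sub hb2).sub hb3').integrable μ) (hb4.integrable μ),
      integral_sub ((hb1.sub hb2).integrable μ) (hb3'.integrable μ),
      integral_sub (hb1.integrable μ) (hb2.integrable μ),
      integral_sub (integrable_const _) ((BddMeas.sum _ fun k _ => hd k).integrable μ),
      integral_finsetSum _ fun k _ => (hd k).integrable μ,
      integral_finsetSum _ fun k _ => ((BddMeas.const _).mul (hc' k)).integrable μ,
      integral_finsetSum _ fun k _ => ((BddMeas.const _).mul (hb3 k)).integrable μ,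
      integral_finsetSum _ fun n _ => ((hl n).mul (BddMeas.const _)).integrable μ] at h1
    simp only [integral_const_mul, integral_mul_const, integral_const, probReal_univ, one_smul]
      at h1
    have h2 : ∀ k, ∫ ω, ∑ m, (state η R (E.rPath ω) (E.cPath ω) t).lam (j + m)
        * (if s k (rot j (E.cPath ω t)) = m then (1 : ℝ) else 0) ∂μ
        = ∑ m, L (j + m) * Q k m := by
      intro k
      rw [integral_finsetSum _ fun m _ => ((hl _).mul (hi' k m)).integrable μ]
      refine Finset.sum_congr rfl fun m _ => ?_
      refine (integral_lam_mul E η R hη hφ hcmin t (j + m)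
        ((hind k m).comp (hrot j))).trans ?_
      congr 1
      exact hlaw j _ (hind k m)
    have h3 : ∑ k, p k * ∫ ω, rot j (E.cPath ω t) (s k (rot j (E.cPath ω t))) k ∂μ
        ≤ ∑ k, p k * (cmin + 1 / (κ * M)) := by
      refine Finset.sum_le_sum fun k _ => mul_le_mul_of_nonneg_left ?_ (hp k).1
      rw [hlaw j _ (hcs k)]
      exact hC k
    simp only [h2] at h1
    change _ + ∑ n, L n * (α / N) ≤ _ at h1
    linarith
  have hNr : (0 : ℝ) < N := by exact_mod_cast hN
  -- averaging over the rotations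
  have havg : ∑ j : Fin N, ∑ k, p k * ∑ m, L (j + m) * Q k m = (∑ k, p k) * ∑ n, L n := by
    rw [Finset.sum_comm, Finset.sum_mul]
    refine Finset.sum_congr rfl fun k _ => ?_
    rw [← Finset.mul_sum, Finset.sum_comm]
    congr 1
    have : ∀ m, ∑ j, L (j + m) * Q k m = (∑ n, L n) * Q k m := fun m => by
      rw [← Finset.sum_mul]
      congr 1
      exact Fintype.sum_equiv (Equiv.addRight m) _ _ fun j => rfl
    simp only [this]
    rw [← Finset.mul_sum, hQ, mul_one]
  have hsum := Finset.sum_le_sum fun j (_ : j ∈ Finset.univ) => hj j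
  simp only [Finset.sum_add_distrib, Finset.sum_sub_distrib, havg, Finset.sum_const,
    Finset.card_univ, Fintype.card_fin, nsmul_eq_mul, ← Finset.sum_mul] at hsum
  have h1 : (N : ℝ) * ((∑ n, L n) * (α / N)) = α * ∑ n, L n := by field_simp
  rw [h1] at hsum
  have h2 : (∑ k, p k) * ∑ n, L n ≤ α * ∑ n, L n :=
    mul_le_mul_of_nonneg_right hpα (Finset.sum_nonneg fun n _ => hL n)
  have h3 : (∑ k, p k) * (1 / (κ * M)) ≤ α * (1 / (κ * M)) :=
    mul_le_mul_of_nonneg_right hpα (by positivity)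
  refine le_of_mul_le_mul_left ?_ hNr
  have h4 : ∑ k, (E.rbar k - cmin) * p k = ∑ k, E.rbar k * p k - (∑ k, p k) * cmin := by
    rw [Finset.sum_mul, ← Finset.sum_sub_distrib]
    exact Finset.sum_congr rfl fun k _ => by ring
  rw [h4]
  nlinarith [mul_le_mul_of_nonneg_left h3 hNr.le]

end UpperBound

/-! ### Orders of magnitude for a long horizon -/

section Asymptotics

open Filter

lemma eventually_mul_rpow_le {a b : ℝ} (hab : a < b) (c : ℝ) {d : ℝ} (hd : 0 < d) :
    ∀ᶠ x : ℝ in atTop, c * x ^ a ≤ d * x ^ b := by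
  filter_upwards [(tendsto_rpow_atTop (sub_pos.mpr hab)).eventually_ge_atTop (c / d),
    eventually_gt_atTop 0] with x hx hx0
  rw [Real.rpow_sub hx0, div_le_div_iff₀ hd (Real.rpow_pos_of_pos hx0 a)] at hx
  linarith

/-- What the proof needs of the horizon `x`. The bounds on `α ^ (1/3) * x ^ β` concern the number
of agents, and `(K + α) / (2 √(6 K α)) * √x` dominates the inverse of the step size. -/
structure LongHorizon (K : ℕ) (α β ε D x : ℝ) : Prop where
  one_le : 1 ≤ x
  one_le_log : 1 ≤ Real.log x
  agents : 2 * K + α + 1 ≤ α ^ (1 / 3 : ℝ) * x ^ β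
  violation_le : α ^ (1 / 3 : ℝ) * x ^ β * (1 + (K + α) / (2 * √(6 * K * α)) * √x) ≤ α * x
  violation_le' : α ^ (1 / 3 : ℝ) * x ^ β * (1 + (K + α) / (2 * √(6 * K * α)) * √x)
    ≤ K / α * √(K * x ^ (1 + 3 * β))
  arms_le : 7 * K ≤ √(α * K * x * Real.log x)
  regret_le : 20 * √(α * K * x * Real.log x) ≤ α ^ (2 / 3 : ℝ) * x ^ (1 - β)
  sublinear : D * (α ^ (2 / 3 : ℝ) * x ^ (1 - β)) ≤ ε * x

lemma eventually_longHorizon {K : ℕ} (hK : 0 < K) {α β ε : ℝ} (hα : 0 < α)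
    (hβ : β ∈ Set.Ioo (0 : ℝ) (1 / 3)) (hε : 0 < ε) (D : ℝ) :
    ∀ᶠ x : ℝ in atTop, LongHorizon K α β ε D x := by
  obtain ⟨hβ0, hβ1⟩ := hβ
  have hKr : (0 : ℝ) < K := by exact_mod_cast hK
  set γ := (K + α) / (2 * √(6 * K * α)) with hγ
  have hγ0 : 0 ≤ γ := by positivity
  have hα3 : 0 < α ^ (1 / 3 : ℝ) := Real.rpow_pos_of_pos hα _
  -- the accumulated violation is of order `x ^ (β + 1/2)`
  have hvio : ∀ x : ℝ, 1 ≤ x → α ^ (1 / 3 : ℝ) * x ^ β * (1 + γ * √x)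
      ≤ α ^ (1 / 3 : ℝ) * (1 + γ) * x ^ (β + 1 / 2) := by
    intro x hx
    have hs : 1 ≤ √x := Real.one_le_sqrt.mpr hx
    have hx0 : 0 < x := by linarith
    rw [Real.rpow_add hx0, ← Real.sqrt_eq_rpow]
    have h1 : 1 + γ * √x ≤ (1 + γ) * √x := by nlinarith
    calc α ^ (1 / 3 : ℝ) * x ^ β * (1 + γ * √x)
        ≤ α ^ (1 / 3 : ℝ) * x ^ β * ((1 + γ) * √x) :=
          mul_le_mul_of_nonneg_left h1 (by positivity)
      _ = _ := by ring
  filter_upwards [eventually_ge_atTop 1, Real.tendsto_log_atTop.eventually_ge_atTop 1,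
    (tendsto_rpow_atTop hβ0).eventually_ge_atTop ((2 * K + α + 1) / α ^ (1 / 3 : ℝ)),
    eventually_mul_rpow_le (show β + 1 / 2 < 1 by linarith) (α ^ (1 / 3 : ℝ) * (1 + γ)) hα,
    eventually_mul_rpow_le (show β + 1 / 2 < (1 + 3 * β) / 2 by linarith)
      (α ^ (1 / 3 : ℝ) * (1 + γ)) (show 0 < K / α * √(K : ℝ) by positivity),
    eventually_ge_atTop (49 * K / α),
    eventually_mul_rpow_le (show (4 / 3 : ℝ) < 2 * (1 - β) by linarith) (1200 * α * K)
      (show 0 < (α ^ (2 / 3 : ℝ)) ^ 2 by positivity),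
    eventually_mul_rpow_le (show 1 - β < 1 by linarith) (D * α ^ (2 / 3 : ℝ)) hε]
    with x h1 hlog hN hv hv' h49 hreg hsub
  have hx0 : 0 < x := by linarith
  refine ⟨h1, hlog, ?_, ?_, ?_, ?_, ?_, ?_⟩
  · rw [div_le_iff₀ hα3] at hN
    linarith
  · rw [Real.rpow_one] at hv
    exact (hvio x h1).trans hv
  · refine (hvio x h1).trans (hv'.trans (le_of_eq ?_))
    rw [Real.sqrt_mul hKr.le, Real.sqrt_eq_rpow (x ^ (1 + 3 * β)), ← Real.rpow_mul hx0.le]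
    ring_nf
  · refine Real.le_sqrt_of_sq_le ?_
    rw [div_le_iff₀ hα] at h49
    have h2 : α * K * x ≤ α * K * x * Real.log x := le_mul_of_one_le_right (by positivity) hlog
    nlinarith
  · have h2 := Real.log_le_rpow_div hx0.le (show (0 : ℝ) < 1 / 3 by norm_num)
    have h3 : 400 * (α * K * x * Real.log x) ≤ (α ^ (2 / 3 : ℝ) * x ^ (1 - β)) ^ 2 := by
      have h4 : x ^ (4 / 3 : ℝ) = x * x ^ (1 / 3 : ℝ) := by
        rw [show (4 / 3 : ℝ) = 1 + 1 / 3 by norm_num, Real.rpow_add hx0, Real.rpow_one]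
      have h5 : x ^ (2 * (1 - β)) = (x ^ (1 - β)) ^ 2 := by
        rw [mul_comm, Real.rpow_mul hx0.le]; norm_cast
      rw [mul_pow, ← h5]
      refine le_trans ?_ hreg
      rw [h4]
      have h6 := mul_le_mul_of_nonneg_left h2 (show 0 ≤ 400 * (α * K * x) by positivity)
      refine le_of_eq_of_le (by ring) (h6.trans (le_of_eq (by ring)))
    have h4 : 20 * √(α * K * x * Real.log x) = √(400 * (α * K * x * Real.log x)) := by
      rw [Real.sqrt_mul (show (0 : ℝ) ≤ 400 by norm_num), show (400 : ℝ) = 20 ^ 2 by norm_num,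
        Real.sqrt_sq (by norm_num)]
    rw [h4]
    exact Real.sqrt_le_iff.mpr ⟨by positivity, h3⟩
  · rw [Real.rpow_one] at hsub
    linarith

end Asymptotics

/-! ### The bounds for the homogeneous system -/

section Homogeneous

lemma sum_crowdCap {N : ℕ} (hN : 0 < N) (α : ℝ) : ∑ n, crowdCap α N n = α := by
  have : (N : ℝ) ≠ 0 := by exact_mod_cast hN.ne'
  simp [crowdCap]
  field_simp

/-- The size of the system and of the step for a long horizon. -/
lemma crowd_facts {K : ℕ} (hK : 0 < K) {α β ε D : ℝ} (hα : 0 < α) {T N : ℕ}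
    (hT : LongHorizon K α β ε D T) (hNdef : N = ⌊α ^ (1 / 3 : ℝ) * (T : ℝ) ^ β⌋₊) {η : ℝ}
    (hη : η = stepSize K T (crowdCap α N)) :
    K + α ≤ N ∧ (N : ℝ) ≤ α ^ (1 / 3 : ℝ) * (T : ℝ) ^ β
      ∧ α ^ (1 / 3 : ℝ) * (T : ℝ) ^ β ≤ 2 * N ∧ 0 < η
      ∧ η * T * (K + α) = 4 * K + 2 * √(6 * K * T * α * Real.log T)
      ∧ (1 + η) / η ≤ 1 + (K + α) / (2 * √(6 * K * α)) * √T := by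
  have hKr : (1 : ℝ) ≤ K := by exact_mod_cast hK
  set A := α ^ (1 / 3 : ℝ) * (T : ℝ) ^ β with hA
  have hA1 := hT.agents
  have hfl : (N : ℝ) ≤ A := by rw [hNdef]; exact Nat.floor_le (by positivity)
  have hfl' : A < N + 1 := by rw [hNdef]; exact Nat.lt_floor_add_one A
  have hN : K + α ≤ N := by linarith
  have hN0 : 0 < N := by
    have : (0 : ℝ) < N := by linarith
    exact_mod_cast this
  have hT0 : (0 : ℝ) < T := by linarith [hT.one_le]
  have hη' : η = (4 * K + 2 * √(6 * K * T * α * Real.log T)) / (T * (K + α)) := by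
    rw [hη, stepSize, sum_crowdCap hN0, min_eq_left hN]
  have hmul : η * T * (K + α) = 4 * K + 2 * √(6 * K * T * α * Real.log T) := by
    rw [hη']; field_simp
  have hη0 : 0 < η := by rw [hη']; positivity
  refine ⟨hN, hfl, by linarith, hη0, hmul, ?_⟩
  have hs : √(6 * K * α) * √T ≤ √(6 * K * T * α * Real.log T) := by
    rw [← Real.sqrt_mul (by positivity)]
    refine Real.sqrt_le_sqrt ?_
    have := le_mul_of_one_le_right (show (0 : ℝ) ≤ 6 * K * α * T by positivity) hT.one_le_log
    linarith
  have hs0 : 0 < √(6 * K * α) := Real.sqrt_pos.mpr (by positivity)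
  rw [add_div, div_self hη0.ne', add_comm]
  refine add_le_add_right ?_ 1
  rw [div_le_iff₀ hη0, div_mul_eq_mul_div, div_mul_eq_mul_div, le_div_iff₀ (by positivity)]
  have hsT : √(T : ℝ) * √(T : ℝ) = T := Real.mul_self_sqrt hT0.le
  have hsT0 : 0 < √(T : ℝ) := Real.sqrt_pos.mpr hT0
  -- multiply `η T (K + α) ≥ 2 √(6Kα) √T` by `√T / T`
  refine le_of_mul_le_mul_right ?_ hsT0
  have h1 : (K + α) * √T * η * √T = 4 * K + 2 * √(6 * K * T * α * Real.log T) := by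
    rw [← hmul,
      show (K + α) * √(T : ℝ) * η * √(T : ℝ) = η * (√(T : ℝ) * √(T : ℝ)) * (K + α) by ring,
      hsT]
  rw [h1]
  nlinarith

variable {Ω : Type*} [MeasurableSpace Ω] {μ : Measure Ω} [IsProbabilityMeasure μ] {N K : ℕ}
  {cmin : ℝ} (E : Environment Ω μ N K cmin) {η : ℝ}

/-- The estimation error in closed form. -/
lemma overestimation_crowd_le (hK : 0 < K) {α β ε D : ℝ} (hα : 0 < α) {T : ℕ}
    (hT : LongHorizon K α β ε D T) (hNdef : N = ⌊α ^ (1 / 3 : ℝ) * (T : ℝ) ^ β⌋₊)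
    (hη : η = stepSize K T (crowdCap α N)) (R : AssignmentRule K (crowdCap α N))
    (hcmin : 0 ≤ cmin) :
    overestimation E η R T ≤ 3 * K + 11 * √(α * K * T * Real.log T) := by
  obtain ⟨hN, hNA, -, hη0, -, hinv⟩ := crowd_facts hK hα hT hNdef hη
  have hN0 : 0 < N := by
    have : (0 : ℝ) < N := by linarith [(Nat.cast_nonneg K : (0 : ℝ) ≤ K)]
    exact_mod_cast this
  have hφ : ∀ n, 0 ≤ crowdCap α N n := fun n => by unfold crowdCap; positivity
  have h1 := overestimation_le E η R hη0 hφ hcmin T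
  rw [sum_crowdCap hN0] at h1
  have hlog : 0 ≤ Real.log T := by linarith [hT.one_le_log]
  have h2 : N * ((1 + η) / η) ≤ α * T := by
    refine le_trans ?_ hT.violation_le
    exact mul_le_mul hNA hinv (by positivity) (by positivity)
  have h3 : √(6 * Real.log T) * √(K * (T * α + N * ((1 + η) / η)))
      ≤ √12 * √(α * K * T * Real.log T) := by
    rw [← Real.sqrt_mul (by positivity), ← Real.sqrt_mul (by norm_num)]
    refine Real.sqrt_le_sqrt ?_
    have h4 : K * (T * α + N * ((1 + η) / η)) ≤ 2 * (K * (α * T)) := by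
      have := mul_le_mul_of_nonneg_left h2 (Nat.cast_nonneg (α := ℝ) K)
      linarith
    have h5 := mul_le_mul_of_nonneg_left h4 (show 0 ≤ 6 * Real.log T by positivity)
    linarith
  have h4 : √(12 : ℝ) ≤ 11 / 3 := Real.sqrt_le_iff.mpr ⟨by norm_num, by norm_num⟩
  have h5 := mul_le_mul_of_nonneg_right h4 (Real.sqrt_nonneg (α * K * T * Real.log T))
  linarith

/-- The shortfall from a level of welfare that the Lagrangian attains in every slot. -/
lemma crowd_shortfall_le (hK : 0 < K) {α β ε D : ℝ} (hα : 0 < α) {T : ℕ}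
    (hT : LongHorizon K α β ε D T) (hNdef : N = ⌊α ^ (1 / 3 : ℝ) * (T : ℝ) ^ β⌋₊)
    (hη : η = stepSize K T (crowdCap α N)) (R : AssignmentRule K (crowdCap α N))
    (hcmin : 0 ≤ cmin) {v : ℝ}
    (hv : ∀ t, v - ∑ k, ∫ ω, max (E.rbar k - rhat η R (E.rPath ω) (E.cPath ω) t k) 0 ∂μ
      ≤ ∫ ω, slotLagrangian E η R t ω ∂μ) :
    T * v - ∑ t ∈ Finset.range T, expWelfare E η R t ≤ 20 * √(α * K * T * Real.log T) := by
  obtain ⟨hN, hNA, -, hη0, hmul, -⟩ := crowd_facts hK hα hT hNdef hη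
  have hNr : (0 : ℝ) < N := by linarith [(Nat.cast_nonneg K : (0 : ℝ) ≤ K)]
  have hN0 : 0 < N := by exact_mod_cast hNr
  have hφ : ∀ n, crowdCap α N n ∈ Set.Icc (0 : ℝ) 1 := fun n => by
    unfold crowdCap
    exact ⟨by positivity,
      (div_le_one hNr).mpr (by linarith [(Nat.cast_nonneg K : (0 : ℝ) ≤ K)])⟩
  have h1 := sum_sub_expWelfare_le E η R hη0 hφ hcmin T hv
  rw [sum_crowdCap hN0, hmul] at h1
  have h2 := overestimation_crowd_le E hK hα hT hNdef hη R hcmin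
  have h3 : √(6 * K * T * α * Real.log T) = √6 * √(α * K * T * Real.log T) := by
    rw [← Real.sqrt_mul (by norm_num)]
    congr 1; ring
  have h4 : √(6 : ℝ) ≤ 3 := Real.sqrt_le_iff.mpr ⟨by norm_num, by norm_num⟩
  have h5 := mul_le_mul_of_nonneg_right h4 (Real.sqrt_nonneg (α * K * T * Real.log T))
  have h6 := hT.arms_le
  have h7 := Real.sqrt_nonneg (α * K * T * Real.log T)
  rw [h3] at h1
  linarith

theorem reg_crowd_le (hK : 0 < K) {α β ε D : ℝ} (hα : 0 < α) {T : ℕ}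
    (hT : LongHorizon K α β ε D T) (hNdef : N = ⌊α ^ (1 / 3 : ℝ) * (T : ℝ) ^ β⌋₊)
    (hη : η = stepSize K T (crowdCap α N)) (R : AssignmentRule K (crowdCap α N))
    (hcmin : 0 ≤ cmin) : Reg E η R T ≤ 20 * √(α * K * T * Real.log T) := by
  obtain ⟨-, -, -, hη0, -, -⟩ := crowd_facts hK hα hT hNdef hη
  have hT0 : (0 : ℝ) < T := by linarith [hT.one_le]
  have hφ : ∀ n, 0 ≤ crowdCap α N n := fun n => by unfold crowdCap; positivity
  have h1 : E.benchmark (crowdCap α N) ≤ (20 * √(α * K * T * Real.log T)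
      + ∑ t ∈ Finset.range T, expWelfare E η R t) / T := by
    refine csSup_le ⟨_, fun _ => 0, measurable_const, fun _ => zero_mem_assignments,
      fun n => ?_, rfl⟩ ?_
    · simpa [util] using hφ n
    · rintro v ⟨x, hx, hxmem, hcap, rfl⟩
      rw [le_div_iff₀ hT0]
      have := crowd_shortfall_le E hK hα hT hNdef hη R hcmin fun t =>
        policy_le_slotLagrangian E η R hη0.le hφ hcmin t hx hxmem hcap
      linarith
  rw [le_div_iff₀ hT0] at h1
  simp only [Reg, Finset.sum_sub_distrib, Finset.sum_const, Finset.card_range, nsmul_eq_mul]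
  linarith

theorem deg_crowd_le (hK : 0 < K) {α β ε D κ : ℝ} (hα : 0 < α) (hκ : 0 < κ) {T : ℕ}
    (hT : LongHorizon K α β ε D T) (hNdef : N = ⌊α ^ (1 / 3 : ℝ) * (T : ℝ) ^ β⌋₊)
    (hη : η = stepSize K T (crowdCap α N)) (R : AssignmentRule K (crowdCap α N))
    (hcmin : 0 ≤ cmin) (hE : E.LinearMass κ) :
    Deg E η R T ≤ (4 * K / κ + 1) * (α ^ (2 / 3 : ℝ) * (T : ℝ) ^ (1 - β)) := by
  obtain ⟨hN, -, hA, hη0, -, -⟩ := crowd_facts hK hα hT hNdef hη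
  have hKr : (0 : ℝ) < K := by exact_mod_cast hK
  have hNr : (0 : ℝ) < N := by linarith
  have hN0 : 0 < N := by exact_mod_cast hNr
  have hT0 : (0 : ℝ) < T := by linarith [hT.one_le]
  have hKN : K ≤ N := by
    have : (K : ℝ) ≤ N := by linarith
    exact_mod_cast this
  have hM : 0 < N / K := Nat.div_pos hKN hK
  have hMr : (0 : ℝ) < (N / K : ℕ) := by exact_mod_cast hM
  -- a group has at least `N / (2 K)` members
  have hM2 : (N : ℝ) ≤ 2 * K * (N / K : ℕ) := by
    have h1 : N < K * (N / K + 1) := Nat.lt_mul_div_succ N hK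
    have h2 : K ≤ K * (N / K) := Nat.le_mul_of_pos_right K hM
    have h3 : N ≤ 2 * K * (N / K) := by nlinarith
    exact_mod_cast h3
  set B := 20 * √(α * K * T * Real.log T) with hB
  have h1 : E.upperBound (crowdCap α N) ≤ (B + ∑ t ∈ Finset.range T, expWelfare E η R t) / T
      + α * (1 / (κ * (N / K : ℕ))) := by
    refine csSup_le ⟨_, fun _ => 0, fun _ => by simp, ?_, rfl⟩ ?_
    · simpa [sum_crowdCap hN0] using hα.le
    · rintro v ⟨p, hp, hpα, rfl⟩
      rw [sum_crowdCap hN0] at hpα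
      rw [← sub_le_iff_le_add, le_div_iff₀ hT0]
      have := crowd_shortfall_le E hK hα hT hNdef hη R hcmin fun t =>
        probabilities_le_slotLagrangian E η R hη0.le hα.le hcmin hκ hE hM (Nat.mul_div_le N K) hp
          hpα hN0 t
      linarith
  rw [← sub_le_iff_le_add, le_div_iff₀ hT0] at h1
  have hexcess : T * (α * (1 / (κ * (N / K : ℕ))))
      ≤ 4 * K / κ * (α ^ (2 / 3 : ℝ) * (T : ℝ) ^ (1 - β)) := by
    have hα1 : α ^ (2 / 3 : ℝ) * α ^ (1 / 3 : ℝ) = α := by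
      rw [← Real.rpow_add hα]; norm_num
    have hT1 : (T : ℝ) ^ (1 - β) * (T : ℝ) ^ β = T := by
      rw [← Real.rpow_add hT0]; simp
    have h2 : α * T = α ^ (2 / 3 : ℝ) * (T : ℝ) ^ (1 - β)
        * (α ^ (1 / 3 : ℝ) * (T : ℝ) ^ β) := by
      calc α * T = (α ^ (2 / 3 : ℝ) * α ^ (1 / 3 : ℝ)) * ((T : ℝ) ^ (1 - β) * (T : ℝ) ^ β) := by
            rw [hα1, hT1]
        _ = _ := by ring
    have h3 : α ^ (1 / 3 : ℝ) * (T : ℝ) ^ β ≤ 4 * K * (N / K : ℕ) := by linarith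
    have h4 : T * (α * (1 / (κ * (N / K : ℕ)))) = α * T / (κ * (N / K : ℕ)) := by ring
    rw [h4, h2, div_le_iff₀ (by positivity)]
    refine (mul_le_mul_of_nonneg_left h3 (by positivity)).trans (le_of_eq ?_)
    field_simp
  have h2 := hT.regret_le
  simp only [Deg, Finset.sum_sub_distrib, Finset.sum_const, Finset.card_range, nsmul_eq_mul]
  linarith

theorem vio_crowd_le (hK : 0 < K) {α β ε D : ℝ} (hα : 0 < α) {T : ℕ}
    (hT : LongHorizon K α β ε D T) (hNdef : N = ⌊α ^ (1 / 3 : ℝ) * (T : ℝ) ^ β⌋₊)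
    (hη : η = stepSize K T (crowdCap α N)) (R : AssignmentRule K (crowdCap α N))
    (hcmin : 0 ≤ cmin) : Vio E η R T ≤ K / α * √(K * (T : ℝ) ^ (1 + 3 * β)) := by
  obtain ⟨-, hNA, -, hη0, -, hinv⟩ := crowd_facts hK hα hT hNdef hη
  have hφ : ∀ n, 0 ≤ crowdCap α N n := fun n => by unfold crowdCap; positivity
  refine (vio_le E η R hη0 hφ hcmin T).trans (le_trans ?_ hT.violation_le')
  exact mul_le_mul hNA hinv (by positivity) (by positivity)

theorem pro_crowd_nonneg (hK : 0 < K) {α β ε D : ℝ} (hα : 0 < α) {T : ℕ}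
    (hT : LongHorizon K α β ε D T) (hNdef : N = ⌊α ^ (1 / 3 : ℝ) * (T : ℝ) ^ β⌋₊)
    (hη : η = stepSize K T (crowdCap α N)) (R : AssignmentRule K (crowdCap α N))
    (hcmin : 0 ≤ cmin) : 0 ≤ Pro E η R T + 20 * √(α * K * T * Real.log T) := by
  obtain ⟨-, -, -, hη0, -, -⟩ := crowd_facts hK hα hT hNdef hη
  have hφ : ∀ n, 0 ≤ crowdCap α N n := fun n => by unfold crowdCap; positivity
  have h1 := neg_overestimation_le_pro E η R hη0.le hφ hcmin T
  have h2 := overestimation_crowd_le E hK hα hT hNdef hη R hcmin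
  have h3 := hT.arms_le
  have h4 := Real.sqrt_nonneg (α * K * T * Real.log T)
  linarith [(Nat.cast_nonneg K : (0 : ℝ) ≤ K)]

end Homogeneous

end IOL

theorem corollary1 :
    ∃ C : ℝ, 0 < C ∧
    ∀ (K : ℕ), 0 < K → ∀ (κ : ℝ), 0 < κ →
    ∃ D : ℝ, 0 < D ∧
    ∀ (α β : ℝ), 0 < α → β ∈ Set.Ioo (0 : ℝ) (1 / 3) → ∀ (ε : ℝ), 0 < ε →
    ∃ T₀ : ℕ, ∀ (T : ℕ), T₀ ≤ T →
    ∀ (N : ℕ), N = ⌊α ^ (1 / 3 : ℝ) * (T : ℝ) ^ β⌋₊ →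
    ∀ (cmin : ℝ), 0 ≤ cmin →
    ∀ (Ω : Type*) [MeasurableSpace Ω] (μ : Measure Ω) [IsProbabilityMeasure μ]
      (E : IOL.Environment Ω μ N K cmin)
      (R : IOL.AssignmentRule K (IOL.crowdCap α N)) (η : ℝ),
      η = IOL.stepSize K T (IOL.crowdCap α N) →
      IOL.TruthfulDominant R ∧
      (∀ ω t n, IOL.ahat η R (E.rPath ω) (E.cPath ω) t n = 1) ∧
      (E.LinearMass κ →
        IOL.Deg E η R T ≤ D * (α ^ (2 / 3 : ℝ) * (T : ℝ) ^ (1 - β)) ∧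
        IOL.Deg E η R T ≤ ε * T) ∧
      IOL.Reg E η R T ≤ C * √(α * K * T * Real.log T) ∧
      IOL.Vio E η R T ≤ C * (K / α * √(K * (T : ℝ) ^ (1 + 3 * β))) ∧
      0 ≤ IOL.Pro E η R T + C * √(α * K * T * Real.log T) := by

  refine ⟨20, by norm_num, fun K hK κ hκ => ⟨4 * K / κ + 1, by positivity, ?_⟩⟩
  intro α β hα hβ ε hε
  obtain ⟨T₀, hT₀⟩ := Filter.eventually_atTop.mp (tendsto_natCast_atTop_atTop.eventually
    (IOL.eventually_longHorizon hK hα hβ hε (4 * K / κ + 1)))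
  refine ⟨T₀, fun T hT N hN cmin hcmin Ω _ μ _ E R η hη => ?_⟩
  have hlong := hT₀ T hT
  have hdeg := fun hE : E.LinearMass κ =>
    IOL.deg_crowd_le E hK hα hκ hlong hN hη R hcmin hE
  refine ⟨IOL.truthfulDominant R, fun ω t n => congrFun (IOL.ahat_eq_one η R _ _ t) n,
    fun hE => ⟨hdeg hE, (hdeg hE).trans hlong.sublinear⟩,
    IOL.reg_crowd_le E hK hα hlong hN hη R hcmin, ?_,
    IOL.pro_crowd_nonneg E hK hα hlong hN hη R hcmin⟩
  refine (IOL.vio_crowd_le E hK hα hlong hN hη R hcmin).trans ?_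
  refine le_mul_of_one_le_left (by positivity) (by norm_num)
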